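/- **Theorem (RKHS approximation).** Let $\Omega\subset\mathbb R^d$ be a bounded open set satisfying an interior cone condition (for example a bounded $C^2$ or Lipschitz domain). Let $\mathbb K\in\{\mathbb R,\mathbb C\}$, let $k:\Omega\times\Omega\to\mathbb K$ be a positive semidefinite kernel with reproducing kernel Hilbert space $\mathcal H_k$ of functions $\Omega\to\mathbb K$, and suppose that $k$ is $s$-smooth with $s>d/2$, i.e. $\mathcal H_k$ embeds continuously into $H^s(\Omega)$, the space of restrictions to $\Omega$ of elements of the Bessel potential space $H^s(\mathbb R^d)$ (each $h\in\mathcal H_k$ being identified with the continuous representative). For points $x_1,\dots,x_N\in\Omega$, $N\ge 1$, let $h_{\mathrm{fill}}=\sup_{x\in\Omega}\min_i|x-x_i|$ be the fill distance and let $K_{ij}=k(x_i,x_j)$. 1. (*Collocation of values.*) There is a constant $C>0$ such that for all $N\ge1$, all $x_1,\dots,x_N\in\Omega$, all $h^*\in\mathcal H_k$ and every $h_N=\sum_j\alpha_jk(\cdot,x_j)$ with $h_N(x_i)=h^*(x_i)$ for $i=1,\dots,N$, $$\sup_{x\in\Omega}|h^*(x)-h_N(x)|\le C\,\|h^*\|_{\mathcal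 H_k}\,h_{\mathrm{fill}}^{\,s-d/2}.$$ 2. (*Collocation of the differential equation.*) Suppose that $s>d/2+2$. Let $G:\mathbb R^d\to\mathbb R^d$ and $\sigma:\mathbb R^d\to\mathbb R^{d\times m}$ be of class $C^2$, $a=\sigma\sigma^{\top}$, $F(x)=G(x)-DG(0)x$ and $\lambda\in\mathbb K$. There is a constant $C>0$ such that for all $N\ge 1$, all $x_1,\dots,x_N\in\Omega$ and all $w\in\mathbb K^d$ the following holds. Let $h^*\in\mathcal H_k$ be a $C^2$ solution of $$G\cdot\nabla h^*+\tfrac12\operatorname{Tr}[a\nabla^2h^*]-\lambda h^*=-w^{\top}F\quad\text{in }\Omega ,$$ suppose that the collocation matrix $A=L+D-\lambda K$, with $L_{ij}=G(x_i)\cdot\nabla_xk(x_i,x_j)$ and $D_{ij}=\frac12\operatorname{Tr}[a(x_i)\nabla_x^2k(x_i,x_j)]$, is invertible, and let $h_N=\sum_j\alpha_jk(\cdot,x_j)$ be the collocation approximation, where $A\alpha=-(w^{\top}F(x_i))_{i}$. Then $$\sup_{x\in\Omega}|h^*(x)-h_N(x)|\le C\,(1+\kappa)\,\|h^*\|_{\mathcal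 H_k}\,h_{\mathrm{fill}}^{\,s-d/2-2},$$ where $\kappa=\sup_{y\in\Omega}\sum_i\bigl|\sum_jk(y,x_j)(A^{-1})_{ji}\bigr|$ is the (absolute) condition number of the collocation system: the norm of the map $b\mapsto\sum_j(A^{-1}b)_jk(\cdot,x_j)$ from $\mathbb K^N$ with the maximum norm to the bounded functions on $\Omega$ with the supremum norm. -/

import Mathlib

open MeasureTheory TemperedDistribution
open scoped SchwartzMap

noncomputable section

namespace KoopmanCollocation

variable {d m N : ℕ}

/-- Interior cone condition: a fixed closed cone (height `r`, half opening angle `θ`) can be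
placed inside `Ω` with its vertex at any given point of `Ω`. -/
def InteriorCone (Ω : Set (EuclideanSpace ℝ (Fin d))) : Prop :=
  ∃ r > 0, ∃ θ ∈ Set.Ioo 0 (Real.pi / 2), ∀ x ∈ Ω, ∃ ξ : EuclideanSpace ℝ (Fin d), ‖ξ‖ = 1 ∧
    ∀ y : EuclideanSpace ℝ (Fin d), ‖y‖ = 1 → Real.cos θ ≤ inner ℝ y ξ →
      ∀ t ∈ Set.Icc (0 : ℝ) r, x + t • y ∈ Ω

/-- `fillDist Ω x = sup_{y ∈ Ω} min_i |y - x_i|`. -/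
def fillDist (Ω : Set (EuclideanSpace ℝ (Fin d))) (x : Fin N → Ω) : ℝ :=
  ⨆ y : Ω, ⨅ i, dist y (x i)

section Operators

variable {𝕜 : Type*} [RCLike 𝕜]

/-- The partial derivative `∂u/∂x_r`. -/
def partialDeriv (r : Fin d) (u : EuclideanSpace ℝ (Fin d) → 𝕜)
    (x : EuclideanSpace ℝ (Fin d)) : 𝕜 :=
  fderiv ℝ u x (EuclideanSpace.single r 1)

/-- `G(x) · ∇u(x)`. -/
def driftTerm (G : EuclideanSpace ℝ (Fin d) → EuclideanSpace ℝ (Fin d))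
    (u : EuclideanSpace ℝ (Fin d) → 𝕜) (x : EuclideanSpace ℝ (Fin d)) : 𝕜 :=
  ∑ r, ((G x r : ℝ) : 𝕜) * partialDeriv r u x

/-- `(1/2) Tr[a(x) ∇²u(x)]` with the diffusion tensor `a = σ σᵀ`. -/
def diffusionTerm (σ : EuclideanSpace ℝ (Fin d) → Matrix (Fin d) (Fin m) ℝ)
    (u : EuclideanSpace ℝ (Fin d) → 𝕜) (x : EuclideanSpace ℝ (Fin d)) : 𝕜 :=
  (1 / 2 : 𝕜) * ∑ r, ∑ q,
    (((σ x * (σ x).transpose) r q : ℝ) : 𝕜) * partialDeriv r (partialDeriv q u) x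

/-- `wᵀ F(x)`, where `F(x) = G(x) - DG(0) x` is the nonlinear part of the drift. -/
def source (G : EuclideanSpace ℝ (Fin d) → EuclideanSpace ℝ (Fin d)) (w : Fin d → 𝕜)
    (x : EuclideanSpace ℝ (Fin d)) : 𝕜 :=
  ∑ r, w r * (((G x - fderiv ℝ G 0 x) r : ℝ) : 𝕜)

/-- A function on `Ω`, extended by zero so that it can be differentiated. Only its derivatives at
points of the open set `Ω` are ever used, and these do not depend on the extension. -/
def ext {Ω : Set (EuclideanSpace ℝ (Fin d))} (u : Ω → 𝕜) : EuclideanSpace ℝ (Fin d) → 𝕜 :=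
  Function.extend Subtype.val u 0

/-- `u` solves `G · ∇u + (1/2) Tr[a ∇²u] - lam u = - wᵀ F` in `Ω`. -/
def IsSolution (Ω : Set (EuclideanSpace ℝ (Fin d)))
    (G : EuclideanSpace ℝ (Fin d) → EuclideanSpace ℝ (Fin d))
    (σ : EuclideanSpace ℝ (Fin d) → Matrix (Fin d) (Fin m) ℝ) (lam : 𝕜) (w : Fin d → 𝕜)
    (u : Ω → 𝕜) : Prop :=
  ContDiffOn ℝ 2 (ext u) Ω ∧
    ∀ x : Ω, driftTerm G (ext u) x + diffusionTerm σ (ext u) x - lam * u x = - source G w x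

end Operators

section Kernel

variable {𝕜 : Type*} [RCLike 𝕜] {Ω : Set (EuclideanSpace ℝ (Fin d))}
  (H : Type*) [NormedAddCommGroup H] [InnerProductSpace 𝕜 H] [CompleteSpace H] [RKHS 𝕜 H Ω 𝕜]

/-- The scalar reproducing kernel `k(x, y)` of the Hilbert space of functions `H`. -/
def ker (x y : Ω) : 𝕜 := RKHS.kernel H x y 1

/-- The kernel is `s`-smooth: its native space `H` embeds continuously into the Sobolev (Bessel
potential) space `H^s(Ω)`, the space of restrictions to `Ω` of the elements of `H^s(ℝ^d)`.
Each `h : H` is, on `Ω`, the continuous representative of an `L²` function `U` with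
`(1 - Δ/(4π²))^(s/2) U = V ∈ L²` and `‖U‖_{H^s} = ‖V‖_{L²} ≤ M ‖h‖`. -/
def IsSmoothKernel (s : ℝ) : Prop :=
  ∃ M : ℝ, ∀ h : H, ∃ (u : EuclideanSpace ℝ (Fin d) → ℂ)
      (U V : Lp ℂ 2 (volume : Measure (EuclideanSpace ℝ (Fin d)))),
    Continuous u ∧ u =ᵐ[volume] U ∧
    besselPotential (EuclideanSpace ℝ (Fin d)) ℂ s
        (U : 𝓢'(EuclideanSpace ℝ (Fin d), ℂ)) = (V : 𝓢'(EuclideanSpace ℝ (Fin d), ℂ)) ∧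
    ‖V‖ ≤ M * ‖h‖ ∧
    ∀ x : Ω, u x = RCLike.map 𝕜 ℂ (h x)

/-- `∑_j α_j k(·, x_j)`. -/
def kernelSum (x : Fin N → Ω) (α : Fin N → 𝕜) (y : Ω) : 𝕜 :=
  ∑ j, α j * ker H y (x j)

/-- `K_ij = k(x_i, x_j)`. -/
def gramMatrix (x : Fin N → Ω) : Matrix (Fin N) (Fin N) 𝕜 :=
  Matrix.of fun i j => ker H (x i) (x j)

/-- `L_ij = G(x_i) · ∇_x k(x_i, x_j)`. -/
def driftMatrix (G : EuclideanSpace ℝ (Fin d) → EuclideanSpace ℝ (Fin d)) (x : Fin N → Ω) :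
    Matrix (Fin N) (Fin N) 𝕜 :=
  Matrix.of fun i j => driftTerm G (ext fun y => ker H y (x j)) (x i)

/-- `D_ij = (1/2) Tr[a(x_i) ∇_x² k(x_i, x_j)]`. -/
def diffusionMatrix (σ : EuclideanSpace ℝ (Fin d) → Matrix (Fin d) (Fin m) ℝ) (x : Fin N → Ω) :
    Matrix (Fin N) (Fin N) 𝕜 :=
  Matrix.of fun i j => diffusionTerm σ (ext fun y => ker H y (x j)) (x i)

/-- The collocation matrix `L + D - lam K`. -/
def collocationMatrix (G : EuclideanSpace ℝ (Fin d) → EuclideanSpace ℝ (Fin d))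
    (σ : EuclideanSpace ℝ (Fin d) → Matrix (Fin d) (Fin m) ℝ) (lam : 𝕜) (x : Fin N → Ω) :
    Matrix (Fin N) (Fin N) 𝕜 :=
  driftMatrix H G x + diffusionMatrix H σ x - lam • gramMatrix H x

/-- The (absolute) condition number of the collocation system with matrix `A`: the norm of the
linear map `b ↦ ∑_j (A⁻¹ b)_j k(·, x_j)` from `𝕜^N` with the maximum norm to the bounded functions
on `Ω` with the supremum norm, that is `sup_{y ∈ Ω} ∑_i |∑_j k(y, x_j) (A⁻¹)_ji|`. -/
def collocationCond (x : Fin N → Ω) (A : Matrix (Fin N) (Fin N) 𝕜) : ℝ :=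
  ⨆ y : Ω, ∑ i, ‖∑ j, ker H y (x j) * A⁻¹ j i‖

end Kernel

end KoopmanCollocation

end

/-!
The estimates rest on a sampling inequality: if `u ∈ H^s(ℝ^d)` vanishes on a set that is `δ`-dense
in `Ω`, then `|∂_L u| ≤ C ‖u‖ δ^(s - d/2 - |L|)` on `Ω` for every derivative `∂_L` of order
`|L| < s - d/2`. It is proved on the Fourier side, which treats integer and fractional `s` alike.

Fix `y ∈ Ω` and set `ρ = δ / ε` with a small fixed `ε`. By the cone condition, `Ω` contains a ball
of radius proportional to `ρ` at distance at most `ρ` from `y` (`InteriorCone.exists_ball`). Close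
to the nodes of a tensor grid in this ball there are points `y + ρ z_i` at which `u` vanishes. Tensor
grids are unisolvent and invertibility of a matrix is an open condition, so a compactness argument
gives weights `a_i`, bounded in `ℓ¹` uniformly in `y` and `ρ`, with `∑ a_i p(z_i) = ∂_L p(0)` for all
polynomials `p` of degree at most `l` (`exists_stable_weights`). Hence `ρ^|L| ∂_L u(y)` is the
integral of the Fourier transform of `u` against a factor of modulus one and the symbol
`∏ (i ζ_k) - ∑ a_i exp(i ζ · z_i)` at `ζ = 2πρξ`. The symbol is `O(|ζ|^(l+1))` at low frequencies,
by Taylor expansion of the exponential, and `O(|ζ|^|L|)` at high ones. Since `l + 1 ≥ s`,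
Cauchy–Schwarz and the scaling `ξ ↦ ρξ` bound the integral by `C ρ^(s - d/2) ‖u‖`
(`exists_sampling_bound`, `exists_fillDist_bound`).

An interpolant in the native space differs from `h` by an element that vanishes at the data points
and is orthogonal to the trial space, so that its norm is at most `‖h‖`; the sampling inequality with
`L = []` is the first estimate. For the differential equation, the collocation solution is compared
with the interpolant `g` of `h`: the collocation matrix maps the difference of their coefficients to
the residuals of `h - g` at the data points. These residuals involve derivatives of order at most
two and are bounded by the sampling inequality (`IsSmoothKernel.exists_pdeOp_bound`), and the
condition number turns this bound into one for the difference in the supremum norm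
(`norm_kernelSum_le_collocationCond`).
-/

noncomputable section

namespace KoopmanCollocation

/-! ### Stable polynomial reproduction -/

/-- The matrix of all monomials of degree at most `l` in each variable, evaluated at the
points `z i`. -/
def monomialMatrix {d l : ℕ} (z : (Fin d → Fin (l + 1)) → EuclideanSpace ℝ (Fin d)) :
    Matrix (Fin d → Fin (l + 1)) (Fin d → Fin (l + 1)) ℝ :=
  Matrix.of fun i b => ∏ k, z i k ^ (b k : ℕ)

lemma continuous_monomialMatrix {d l : ℕ} :
    Continuous (monomialMatrix : ((Fin d → Fin (l + 1)) → EuclideanSpace ℝ (Fin d)) → _) := by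
  unfold monomialMatrix
  refine continuous_matrix fun i b => ?_
  simp only [Matrix.of_apply]
  fun_prop

/-- The integer tensor grid, scaled by `c`. -/
def tensorGrid {d l : ℕ} (c : ℝ) (i : Fin d → Fin (l + 1)) : EuclideanSpace ℝ (Fin d) :=
  WithLp.toLp 2 fun k => c * (i k : ℕ)

/-- Tensor grids are unisolvent: a polynomial of degree at most `l` in each variable that vanishes
on a grid with `l + 1` nodes in each direction is zero. -/
lemma det_monomialMatrix_grid_ne_zero {d l : ℕ} {c : ℝ} (hc : c ≠ 0)
    (w : EuclideanSpace ℝ (Fin d)) :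
    (monomialMatrix (l := l) fun i => w + tensorGrid c i).det ≠ 0 := by
  classical
  intro h0
  obtain ⟨v, hv0, hv⟩ := Matrix.exists_mulVec_eq_zero_iff.mpr h0
  let e : (Fin d → Fin (l + 1)) → (Fin d →₀ ℕ) := fun b =>
    Finsupp.equivFunOnFinite.symm fun k => (b k : ℕ)
  have he : Function.Injective e := fun b b' hbb => by
    funext k
    have := DFunLike.congr_fun hbb k
    exact Fin.ext this
  let P : MvPolynomial (Fin d) ℝ := ∑ b, MvPolynomial.monomial (e b) (v b)
  have hP : P = 0 := by
    refine MvPolynomial.eq_zero_of_eval_zero_at_prod_finset P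
      (fun k => Finset.univ.image fun a : Fin (l + 1) => w k + c * (a : ℕ)) ?_ ?_
    · intro k
      rw [Finset.card_image_of_injective]
      · simp only [Finset.card_univ, Fintype.card_fin, Nat.lt_succ_iff]
        refine (MvPolynomial.degreeOf_sum_le _ _ _).trans (Finset.sup_le fun b _ => ?_)
        refine (MvPolynomial.degreeOf_le_iff).mpr fun m hm => ?_
        have := MvPolynomial.support_monomial_subset hm
        rw [Finset.mem_singleton] at this
        subst this
        exact Nat.lt_succ_iff.mp (b k).2
      · intro a a' haa
        simp only [add_right_inj, mul_eq_mul_left_iff, hc, or_false, Nat.cast_inj] at haa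
        exact Fin.ext haa
    · intro x hx
      simp only [Finset.mem_image, Finset.mem_univ, true_and] at hx
      choose i hi using hx
      have := congrFun hv i
      simp only [Matrix.mulVec, dotProduct, monomialMatrix, Matrix.of_apply, Pi.zero_apply] at this
      rw [← this]
      simp only [P, map_sum, MvPolynomial.eval_monomial]
      refine Finset.sum_congr rfl fun b _ => ?_
      rw [mul_comm, Finsupp.prod_fintype _ _ (fun k => pow_zero _)]
      congr 1
      refine Finset.prod_congr rfl fun k _ => ?_
      rw [← hi k]
      rfl
  apply hv0
  funext b
  have := congrArg (MvPolynomial.coeff (e b)) hP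
  simpa [P, MvPolynomial.coeff_sum, MvPolynomial.coeff_monomial, he.eq_iff] using this

/-- If the nodes are unisolvent, solving the transposed system with the values of a linear
functional `T` on the monomials as right-hand side gives weights that represent `T` as a combination
of point evaluations. -/
lemma sum_weights_eval {d l : ℕ} (z : (Fin d → Fin (l + 1)) → EuclideanSpace ℝ (Fin d))
    (hz : (monomialMatrix z).det ≠ 0) (T : MvPolynomial (Fin d) ℝ →ₗ[ℝ] ℝ)
    (P : MvPolynomial (Fin d) ℝ) (hP : ∀ k, P.degreeOf k ≤ l) :
    ∑ i, ((monomialMatrix z).transpose⁻¹.mulVec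
      (fun b => T (MvPolynomial.monomial (Finsupp.equivFunOnFinite.symm fun k => (b k : ℕ)) 1))) i
        * MvPolynomial.eval (fun k => z i k) P = T P := by
  set t : (Fin d → Fin (l + 1)) → ℝ := fun b =>
    T (MvPolynomial.monomial (Finsupp.equivFunOnFinite.symm fun k => (b k : ℕ)) 1) with ht
  set a := (monomialMatrix z).transpose⁻¹.mulVec t with ha
  have hVa : (monomialMatrix z).transpose.mulVec a = t := by
    rw [ha, Matrix.mulVec_mulVec, Matrix.mul_nonsing_inv, Matrix.one_mulVec]
    rw [Matrix.det_transpose]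
    exact isUnit_iff_ne_zero.mpr hz
  rw [P.as_sum]
  simp only [map_sum, Finset.mul_sum]
  rw [Finset.sum_comm]
  refine Finset.sum_congr rfl fun m hm => ?_
  have hml : ∀ k, m k < l + 1 := fun k =>
    Nat.lt_succ_iff.mpr ((MvPolynomial.degreeOf_le_iff.mp (hP k)) m hm)
  have hb := congrFun hVa fun k => ⟨m k, hml k⟩
  have hm' : (Finsupp.equivFunOnFinite.symm fun k => m k) = m := by ext; rfl
  simp only [Matrix.mulVec, dotProduct, Matrix.transpose_apply, monomialMatrix, Matrix.of_apply,
    ht, hm'] at hb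
  have hsm : MvPolynomial.monomial m (MvPolynomial.coeff m P)
      = MvPolynomial.coeff m P • MvPolynomial.monomial m (1 : ℝ) := by
    rw [MvPolynomial.smul_monomial, smul_eq_mul, mul_one]
  rw [hsm, map_smul, ← hb, smul_eq_mul, Finset.mul_sum]
  refine Finset.sum_congr rfl fun i _ => ?_
  rw [MvPolynomial.smul_eval, MvPolynomial.eval_monomial,
    Finsupp.prod_fintype _ _ (fun k => pow_zero _)]
  ring

/-- `T P = ∂_L P (0)`, where `∂_L` is the composition of the partial derivatives in the list
`L` of indices. -/
def derivAtZero {d : ℕ} : List (Fin d) → MvPolynomial (Fin d) ℝ →ₗ[ℝ] ℝ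
  | [] => (MvPolynomial.aeval (0 : Fin d → ℝ)).toLinearMap
  | k :: L => derivAtZero L ∘ₗ (MvPolynomial.pderiv k).toLinearMap

/-- The polynomial `(ζ · X)^j / j!`. -/
def linPow {d : ℕ} (ζ : Fin d → ℝ) (j : ℕ) : MvPolynomial (Fin d) ℝ :=
  MvPolynomial.C ((j.factorial : ℝ)⁻¹) * (∑ k, MvPolynomial.C (ζ k) * MvPolynomial.X k) ^ j

lemma pderiv_linPow_zero {d : ℕ} (ζ : Fin d → ℝ) (k : Fin d) :
    MvPolynomial.pderiv k (linPow ζ 0) = 0 := by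
  simp [linPow]

lemma pderiv_linPow_succ {d : ℕ} (ζ : Fin d → ℝ) (k : Fin d) (j : ℕ) :
    MvPolynomial.pderiv k (linPow ζ (j + 1)) = ζ k • linPow ζ j := by
  classical
  have h : MvPolynomial.pderiv k (∑ i, MvPolynomial.C (ζ i) * MvPolynomial.X i)
      = MvPolynomial.C (ζ k) := by
    simp [map_sum, MvPolynomial.pderiv_X, Pi.single_apply]
  rw [linPow, MvPolynomial.pderiv_C_mul, Derivation.leibniz_pow, h, linPow,
    MvPolynomial.smul_eq_C_mul, Nat.add_sub_cancel, smul_eq_mul, nsmul_eq_mul]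
  have h2 : ((j + 1 : ℕ) : MvPolynomial (Fin d) ℝ) = MvPolynomial.C ((j + 1 : ℕ) : ℝ) := by simp
  have h3 : (((j + 1).factorial : ℝ)⁻¹) * ((j + 1 : ℕ) : ℝ) = (j.factorial : ℝ)⁻¹ := by
    rw [Nat.factorial_succ]
    have : ((j + 1 : ℕ) : ℝ) ≠ 0 := by positivity
    push_cast at this ⊢
    field_simp
  rw [h2, ← h3, MvPolynomial.C_mul]
  ring

lemma derivAtZero_linPow {d : ℕ} (ζ : Fin d → ℝ) (L : List (Fin d)) (j : ℕ) :
    derivAtZero L (linPow ζ j) = if j = L.length then (L.map ζ).prod else 0 := by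
  induction L generalizing j with
  | nil =>
    rcases j with _ | j
    · simp [derivAtZero, linPow]
    · simp [derivAtZero, linPow]
  | cons k L ih =>
    rcases j with _ | j
    · simp [derivAtZero, pderiv_linPow_zero]
    · simp [derivAtZero, pderiv_linPow_succ, ih]

lemma degreeOf_linPow_le {d : ℕ} (ζ : Fin d → ℝ) (j : ℕ) (k : Fin d) :
    (linPow ζ j).degreeOf k ≤ j := by
  refine (MvPolynomial.degreeOf_le_totalDegree _ _).trans ?_
  refine (MvPolynomial.totalDegree_mul _ _).trans ?_
  rw [MvPolynomial.totalDegree_C, zero_add]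
  refine (MvPolynomial.totalDegree_pow _ _).trans ?_
  have : (∑ i, MvPolynomial.C (ζ i) * MvPolynomial.X i : MvPolynomial (Fin d) ℝ).totalDegree
      ≤ 1 := by
    refine MvPolynomial.totalDegree_finsetSum_le fun i _ => ?_
    refine (MvPolynomial.totalDegree_mul _ _).trans ?_
    simp
  nlinarith

/-- Local polynomial reproduction, uniformly in the centre `w` of the grid and stable under
perturbation of its nodes: nodes near the grid admit weights with bounded `ℓ¹` norm that reproduce
the derivative `∂_L` at the origin on all polynomials `(ζ · X)^j / j!`, `j ≤ l`. -/
lemma exists_stable_weights (d l : ℕ) (L : List (Fin d)) {r : ℝ} (hr : 0 < r) :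
    ∃ g : (Fin d → Fin (l + 1)) → EuclideanSpace ℝ (Fin d), (∀ i, ‖g i‖ ≤ r) ∧
      ∃ ε > 0, ε ≤ 1 ∧ ∃ A : ℝ, 0 ≤ A ∧ ∀ w : EuclideanSpace ℝ (Fin d), ‖w‖ ≤ 1 →
        ∀ z : (Fin d → Fin (l + 1)) → EuclideanSpace ℝ (Fin d),
          (∀ i, dist (z i) (w + g i) ≤ ε) →
          ∃ a : (Fin d → Fin (l + 1)) → ℝ, ∑ i, |a i| ≤ A ∧
            ∀ j ≤ l, ∀ ζ : EuclideanSpace ℝ (Fin d),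
              ∑ i, a i * (inner ℝ ζ (z i) ^ j / (j.factorial : ℝ)) =
                if j = L.length then (L.map fun k => ζ k).prod else 0 := by
  classical
  set B : ℝ := ∑ i : Fin d → Fin (l + 1), ‖tensorGrid 1 i‖ with hB
  have hB0 : 0 ≤ B := Finset.sum_nonneg fun _ _ => norm_nonneg _
  set c : ℝ := r / (B + 1) with hc
  have hc0 : 0 < c := by positivity
  refine ⟨tensorGrid c, fun i => ?_, ?_⟩
  · have h1 : tensorGrid c i = c • tensorGrid 1 i := by
      ext k; simp [tensorGrid]
    have h2 : ‖tensorGrid 1 i‖ ≤ B :=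
      Finset.single_le_sum (f := fun i => ‖tensorGrid (l := l) (d := d) 1 i‖)
        (fun _ _ => norm_nonneg _) (Finset.mem_univ i)
    rw [h1, norm_smul, Real.norm_of_nonneg hc0.le]
    calc c * ‖tensorGrid 1 i‖ ≤ c * (B + 1) := by gcongr; linarith
      _ = r := by rw [hc]; field_simp
  set S : Set ((Fin d → Fin (l + 1)) → EuclideanSpace ℝ (Fin d)) :=
    {z | (monomialMatrix z).det ≠ 0} with hS
  set K : Set ((Fin d → Fin (l + 1)) → EuclideanSpace ℝ (Fin d)) :=
    (fun w i => w + tensorGrid c i) '' Metric.closedBall 0 1 with hK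
  have hdet : Continuous fun z : (Fin d → Fin (l + 1)) → EuclideanSpace ℝ (Fin d) =>
      (monomialMatrix z).det := continuous_monomialMatrix.matrix_det
  have hSo : IsOpen S := isOpen_ne_fun hdet continuous_const
  have hKc : IsCompact K := (isCompact_closedBall _ _).image (by fun_prop)
  have hKS : K ⊆ S := by
    rintro _ ⟨w, -, rfl⟩
    exact det_monomialMatrix_grid_ne_zero hc0.ne' w
  -- `K` is the compact set of all admissible unperturbed grids. The perturbations allowed are those
  -- that stay in a closed neighbourhood of `K` on which the determinant does not vanish; there the
  -- weights are continuous functions of the nodes, hence bounded.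
  obtain ⟨δ, hδ, hδS⟩ := hKc.exists_cthickening_subset_open hSo hKS
  set t : (Fin d → Fin (l + 1)) → ℝ := fun b => derivAtZero L
    (MvPolynomial.monomial (Finsupp.equivFunOnFinite.symm fun k => (b k : ℕ)) 1) with ht
  have hcont : ContinuousOn (fun z => ∑ i, |((monomialMatrix z).transpose⁻¹.mulVec t) i|)
      (Metric.cthickening δ K) := by
    have h1 : ContinuousOn (fun z => (monomialMatrix z).transpose⁻¹) (Metric.cthickening δ K) := by
      simp only [Matrix.inv_def, Ring.inverse_eq_inv', Matrix.det_transpose]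
      refine ContinuousOn.smul (hdet.continuousOn.inv₀ fun z hz => hδS hz) ?_
      exact (continuous_monomialMatrix.matrix_transpose.matrix_adjugate).continuousOn
    refine continuousOn_finsetSum _ fun i _ => ContinuousOn.abs ?_
    simp only [Matrix.mulVec, dotProduct]
    refine continuousOn_finsetSum _ fun b _ => ContinuousOn.mul ?_ continuousOn_const
    exact (continuous_apply b).comp_continuousOn ((continuous_apply i).comp_continuousOn h1)
  obtain ⟨A, hA⟩ := (hKc.cthickening).exists_bound_of_continuousOn hcont
  refine ⟨min δ 1, lt_min hδ one_pos, min_le_right _ _, max A 0, le_max_right _ _, ?_⟩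
  intro w hw z hz
  have hzK : z ∈ Metric.cthickening δ K := by
    refine Metric.mem_cthickening_of_dist_le z (fun i => w + tensorGrid c i) δ K
      ⟨w, by simpa using hw, rfl⟩ ?_
    exact (dist_pi_le_iff hδ.le).mpr fun i => (hz i).trans (min_le_left _ _)
  refine ⟨(monomialMatrix z).transpose⁻¹.mulVec t,
    (le_abs_self _).trans ((hA z hzK).trans (le_max_left _ _)), fun j hj ζ => ?_⟩
  rw [← derivAtZero_linPow, ← sum_weights_eval z (hδS hzK) (derivAtZero L)
    (linPow (fun k => ζ k) j) fun k => (degreeOf_linPow_le _ _ _).trans hj]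
  refine Finset.sum_congr rfl fun i _ => ?_
  congr 1
  simp only [linPow, map_mul, MvPolynomial.eval_C, map_pow, map_sum, MvPolynomial.eval_X]
  rw [div_eq_inv_mul]
  congr 2
  simp [PiLp.inner_apply, mul_comm]

/-! ### The Fourier symbol of the reproduction error -/

lemma norm_prod_list_le {d : ℕ} (c : ℂ) (L : List (Fin d)) (ζ : EuclideanSpace ℝ (Fin d)) :
    ‖(L.map fun k => c * (ζ k : ℂ)).prod‖ ≤ (‖c‖ * ‖ζ‖) ^ L.length := by
  induction L with
  | nil => simp
  | cons k L ih =>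
    rw [List.map_cons, List.prod_cons, norm_mul, norm_mul, List.length_cons, pow_succ']
    have : ‖(ζ k : ℂ)‖ ≤ ‖ζ‖ := by
      rw [Complex.norm_real]; exact PiLp.norm_apply_le ζ k
    gcongr

/-- The Fourier symbol of the functional `u ↦ ∂_L u(0) - ∑ i, a i * u (z i)`. -/
def errorSymbol {d : ℕ} {ι : Type*} [Fintype ι] (L : List (Fin d)) (a : ι → ℝ)
    (z : ι → EuclideanSpace ℝ (Fin d)) (ζ : EuclideanSpace ℝ (Fin d)) : ℂ :=
  (L.map fun k => Complex.I * (ζ k : ℂ)).prod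
    - ∑ i, (a i : ℂ) * Complex.exp ((inner ℝ ζ (z i) : ℝ) * Complex.I)

lemma continuous_list_prod_coord {d : ℕ} (c : ℂ) (L : List (Fin d)) :
    Continuous fun ζ : EuclideanSpace ℝ (Fin d) => (L.map fun k => c * (ζ k : ℂ)).prod := by
  induction L with
  | nil => simpa using continuous_const
  | cons k L ih =>
    simp only [List.map_cons, List.prod_cons]
    exact (by fun_prop : Continuous fun ζ : EuclideanSpace ℝ (Fin d) => c * (ζ k : ℂ)).mul ih

lemma continuous_errorSymbol {d : ℕ} {ι : Type*} [Fintype ι] (L : List (Fin d)) (a : ι → ℝ)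
    (z : ι → EuclideanSpace ℝ (Fin d)) : Continuous (errorSymbol L a z) := by
  unfold errorSymbol
  exact (continuous_list_prod_coord _ L).sub (by fun_prop)

lemma norm_errorSymbol_le_of_one_le {d : ℕ} {ι : Type*} [Fintype ι] (L : List (Fin d)) {a : ι → ℝ}
    {A : ℝ} (hA : ∑ i, |a i| ≤ A) (z : ι → EuclideanSpace ℝ (Fin d))
    {ζ : EuclideanSpace ℝ (Fin d)} (hζ : 1 ≤ ‖ζ‖) :
    ‖errorSymbol L a z ζ‖ ≤ (1 + A) * ‖ζ‖ ^ L.length := by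
  have hA0 : 0 ≤ A := (Finset.sum_nonneg fun _ _ => abs_nonneg _).trans hA
  have h1 := norm_prod_list_le Complex.I L ζ
  rw [Complex.norm_I, one_mul] at h1
  have h2 : ‖∑ i, (a i : ℂ) * Complex.exp ((inner ℝ ζ (z i) : ℝ) * Complex.I)‖ ≤ A := by
    refine (norm_sum_le _ _).trans (le_trans (le_of_eq ?_) hA)
    refine Finset.sum_congr rfl fun i _ => ?_
    rw [norm_mul, Complex.norm_exp_ofReal_mul_I, mul_one, Complex.norm_real, Real.norm_eq_abs]
  have h3 : 1 ≤ ‖ζ‖ ^ L.length := one_le_pow₀ hζ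
  calc ‖errorSymbol L a z ζ‖ ≤ ‖ζ‖ ^ L.length + A := (norm_sub_le _ _).trans (add_le_add h1 h2)
    _ ≤ (1 + A) * ‖ζ‖ ^ L.length := by nlinarith

/-- At low frequencies the symbol is as small as the Taylor remainder of the exponential, because
the weights reproduce `∂_L` on the Taylor polynomials. -/
lemma norm_errorSymbol_le_of_le_one {d l : ℕ} {ι : Type*} [Fintype ι] [Nonempty ι]
    {L : List (Fin d)}
    (hL : L.length ≤ l) {a : ι → ℝ} {A R : ℝ} (hA : ∑ i, |a i| ≤ A)
    {z : ι → EuclideanSpace ℝ (Fin d)} (hz : ∀ i, ‖z i‖ ≤ R)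
    (ha : ∀ j ≤ l, ∀ ζ : EuclideanSpace ℝ (Fin d),
      ∑ i, a i * (inner ℝ ζ (z i) ^ j / (j.factorial : ℝ)) =
        if j = L.length then (L.map fun k => ζ k).prod else 0)
    {ζ : EuclideanSpace ℝ (Fin d)} (hζ : ‖ζ‖ ≤ 1) :
    ‖errorSymbol L a z ζ‖ ≤ A * (R ^ (l + 1) * Real.exp R) * ‖ζ‖ ^ (l + 1) := by
  obtain ⟨i₀⟩ := ‹Nonempty ι›
  have hR : 0 ≤ R := (norm_nonneg _).trans (hz i₀)
  have hprod : (L.map fun k => Complex.I * (ζ k : ℂ)).prod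
      = Complex.I ^ L.length * (((L.map fun k => ζ k).prod : ℝ) : ℂ) := by
    clear ha hL
    induction L with
    | nil => simp
    | cons k L ih =>
      simp only [List.map_cons, List.prod_cons, ih, List.length_cons]
      push_cast
      ring
  have key : (L.map fun k => Complex.I * (ζ k : ℂ)).prod
      = ∑ i, (a i : ℂ) * ∑ j ∈ Finset.range (l + 1),
          ((inner ℝ ζ (z i) : ℝ) * Complex.I) ^ j / (j.factorial : ℂ) := by
    simp only [Finset.mul_sum]
    rw [Finset.sum_comm]
    have h1 : ∀ j ∈ Finset.range (l + 1), ∑ i, (a i : ℂ) *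
        (((inner ℝ ζ (z i) : ℝ) * Complex.I) ^ j / (j.factorial : ℂ))
        = if j = L.length then Complex.I ^ j * (((L.map fun k => ζ k).prod : ℝ) : ℂ) else 0 := by
      intro j hj
      have h2 := congrArg (fun t : ℝ => Complex.I ^ j * (t : ℂ))
        (ha j (Nat.lt_succ_iff.mp (Finset.mem_range.mp hj)) ζ)
      have h3 : Complex.I ^ j * ((if j = L.length then (L.map fun k => ζ k).prod else 0 : ℝ) : ℂ)
          = if j = L.length then Complex.I ^ j * (((L.map fun k => ζ k).prod : ℝ) : ℂ) else 0 := by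
        split_ifs <;> simp
      rw [← h3, ← h2]
      push_cast
      rw [Finset.mul_sum]
      refine Finset.sum_congr rfl fun i _ => ?_
      rw [mul_pow]
      ring
    rw [Finset.sum_congr rfl h1, Finset.sum_ite_eq' (Finset.range (l + 1)) L.length, if_pos, hprod]
    exact Finset.mem_range.mpr (Nat.lt_succ_iff.mpr hL)
  rw [errorSymbol, key, ← Finset.sum_sub_distrib]
  have hi : ∀ i, ‖(a i : ℂ) * ∑ j ∈ Finset.range (l + 1),
      ((inner ℝ ζ (z i) : ℝ) * Complex.I) ^ j / (j.factorial : ℂ)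
        - (a i : ℂ) * Complex.exp ((inner ℝ ζ (z i) : ℝ) * Complex.I)‖
      ≤ |a i| * (R ^ (l + 1) * Real.exp R * ‖ζ‖ ^ (l + 1)) := by
    intro i
    rw [← mul_sub, norm_mul, Complex.norm_real, Real.norm_eq_abs, norm_sub_rev]
    refine mul_le_mul_of_nonneg_left ?_ (abs_nonneg _)
    refine (Complex.norm_exp_sub_sum_le_norm_mul_exp _ _).trans ?_
    have h4 : ‖((inner ℝ ζ (z i) : ℝ) : ℂ) * Complex.I‖ ≤ ‖ζ‖ * R := by
      rw [norm_mul, Complex.norm_I, mul_one, Complex.norm_real, Real.norm_eq_abs]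
      exact (abs_real_inner_le_norm _ _).trans (by gcongr; exact hz i)
    have h5 : ‖ζ‖ * R ≤ R := mul_le_of_le_one_left hR hζ
    calc _ ≤ (‖ζ‖ * R) ^ (l + 1) * Real.exp R := by
          gcongr
          exact h4.trans h5
      _ = _ := by rw [mul_pow]; ring
  refine (norm_sum_le _ _).trans ((Finset.sum_le_sum fun i _ => hi i).trans ?_)
  rw [← Finset.sum_mul, mul_assoc A]
  gcongr

/-! ### Weighted Cauchy–Schwarz estimates on the Fourier side -/

/-- The `L²(ℝ^d)` norm of `(1 + |ζ|)^(-q)`. -/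
def decayNorm (d : ℕ) (q : ℝ) : ℝ :=
  (∫ ζ : EuclideanSpace ℝ (Fin d), (1 + ‖ζ‖) ^ (-(2 * q))) ^ (1 / 2 : ℝ)

lemma decayNorm_nonneg (d : ℕ) (q : ℝ) : 0 ≤ decayNorm d q :=
  Real.rpow_nonneg (integral_nonneg fun _ => by positivity) _

/-- Cauchy–Schwarz against the dilated weight `(1 + c|ξ|)^(-q)`, whose `L²` norm is
`c^(-d/2)` times that of the undilated one. -/
lemma integral_norm_mul_decay_le {d : ℕ} {q c : ℝ} (hq : (d : ℝ) / 2 < q) (hc : 0 < c)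
    (f : Lp ℂ 2 (volume : Measure (EuclideanSpace ℝ (Fin d)))) :
    Integrable (fun ξ => ‖f ξ‖ * (1 + c * ‖ξ‖) ^ (-q)) ∧
      ∫ ξ, ‖f ξ‖ * (1 + c * ‖ξ‖) ^ (-q) ≤ ‖f‖ * (c ^ (-((d : ℝ) / 2)) * decayNorm d q) := by
  set g : EuclideanSpace ℝ (Fin d) → ℝ := fun ξ => (1 + c * ‖ξ‖) ^ (-q) with hg
  have hgpos : ∀ ξ, 0 ≤ g ξ := fun ξ => by positivity
  have hgc : Continuous g := by
    refine Continuous.rpow_const (by fun_prop) fun ξ => Or.inl ?_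
    positivity
  have hg2 : ∀ ξ, g ξ ^ 2 = (1 + ‖c • ξ‖) ^ (-(2 * q)) := fun ξ => by
    have h1 : (0 : ℝ) ≤ 1 + c * ‖ξ‖ := by positivity
    rw [norm_smul, Real.norm_of_nonneg hc.le, hg, ← Real.rpow_natCast, ← Real.rpow_mul h1]
    congr 1; push_cast; ring
  have hint : Integrable (fun ζ : EuclideanSpace ℝ (Fin d) => (1 + ‖ζ‖) ^ (-(2 * q))) := by
    refine integrable_one_add_norm ?_
    rw [finrank_euclideanSpace_fin]
    linarith
  have hgm : MemLp g 2 := by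
    rw [memLp_two_iff_integrable_sq hgc.aestronglyMeasurable]
    simp only [hg2]
    exact hint.comp_smul hc.ne'
  have hfm : MemLp (fun ξ => ‖f ξ‖) 2 := (Lp.memLp f).norm
  refine ⟨hfm.integrable_mul hgm, ?_⟩
  have h2 : ENNReal.ofReal 2 = 2 := by norm_num
  have hH := integral_mul_le_Lp_mul_Lq_of_nonneg (μ := volume) (p := 2) (q := 2)
    Real.HolderConjugate.two_two (f := fun ξ => ‖f ξ‖) (g := g)
    (Filter.Eventually.of_forall fun _ => norm_nonneg _) (Filter.Eventually.of_forall hgpos)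
    (by rw [h2]; exact hfm) (by rw [h2]; exact hgm)
  refine hH.trans (le_of_eq ?_)
  have hf : (∫ ξ, ‖f ξ‖ ^ (2 : ℝ)) ^ (1 / 2 : ℝ) = ‖f‖ := by
    rw [Lp.norm_def, (Lp.memLp f).eLpNorm_eq_integral_rpow_norm (by norm_num) (by norm_num),
      ENNReal.toReal_ofReal (by positivity)]
    norm_num
  have hgi : (∫ ξ, g ξ ^ (2 : ℝ)) ^ (1 / 2 : ℝ) = c ^ (-((d : ℝ) / 2)) * decayNorm d q := by
    have h3 : ∀ ξ, g ξ ^ (2 : ℝ) = (1 + ‖c • ξ‖) ^ (-(2 * q)) := fun ξ => by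
      rw [← hg2, ← Real.rpow_natCast]; norm_num
    simp only [h3]
    rw [Measure.integral_comp_smul volume
      (fun ζ : EuclideanSpace ℝ (Fin d) => (1 + ‖ζ‖) ^ (-(2 * q))) c, smul_eq_mul,
      Real.mul_rpow (abs_nonneg _) (integral_nonneg fun _ => by positivity),
      finrank_euclideanSpace_fin, decayNorm]
    congr 1
    rw [abs_of_pos (by positivity), ← Real.rpow_natCast, ← Real.rpow_neg hc.le,
      ← Real.rpow_mul hc.le]
    congr 1; ring
  rw [hf, hgi]

lemma rpow_one_add_sq_mul_pow_le {s t : ℝ} (hs : 0 ≤ s) (ht : 0 ≤ t) (n : ℕ) :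
    t ^ n * (1 + t ^ 2) ^ (-s / 2) ≤ 2 ^ (s / 2) * (1 + t) ^ (-(s - n)) := by
  have h1 : (1 + t) ^ s ≤ 2 ^ (s / 2) * (1 + t ^ 2) ^ (s / 2) := by
    rw [← Real.mul_rpow (by norm_num) (by positivity)]
    have : (1 + t) ^ s = ((1 + t) ^ 2) ^ (s / 2) := by
      rw [← Real.rpow_natCast, ← Real.rpow_mul (by positivity)]
      congr 1; push_cast; ring
    rw [this]
    refine Real.rpow_le_rpow (by positivity) ?_ (by positivity)
    nlinarith [sq_nonneg (1 - t)]
  have h2 : (1 + t) ^ (-(s - n)) = (1 + t) ^ n / (1 + t) ^ s := by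
    rw [neg_sub, Real.rpow_sub (by positivity), Real.rpow_natCast]
  rw [h2, neg_div, Real.rpow_neg (by positivity), ← div_eq_mul_inv, ← mul_div_assoc,
    div_le_div_iff₀ (by positivity) (by positivity)]
  have h3 : t ^ n ≤ (1 + t) ^ n := by gcongr; linarith
  calc t ^ n * (1 + t) ^ s ≤ (1 + t) ^ n * (2 ^ (s / 2) * (1 + t ^ 2) ^ (s / 2)) := by gcongr
    _ = _ := by ring

/-- The singular majorant `(1 + |ξ|²)^(-s/2) ≤ |ξ|^(-s)`, which has the right scaling, is compensated
at the origin by a symbol that vanishes there to order `l + 1 ≥ s`. -/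
lemma rpow_one_add_sq_mul_symbol_le {d l n : ℕ} {s C c : ℝ} (hs : 0 ≤ s) (hns : (n : ℝ) ≤ s)
    (hsl : s ≤ l + 1) (hC : 0 ≤ C) (hc : 0 < c) {m : EuclideanSpace ℝ (Fin d) → ℂ}
    (hlow : ∀ ζ, ‖ζ‖ ≤ 1 → ‖m ζ‖ ≤ C * ‖ζ‖ ^ (l + 1))
    (hhigh : ∀ ζ, 1 ≤ ‖ζ‖ → ‖m ζ‖ ≤ C * ‖ζ‖ ^ n) (ξ : EuclideanSpace ℝ (Fin d)) :
    (1 + ‖ξ‖ ^ 2) ^ (-s / 2) * ‖m (c • ξ)‖ ≤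
      C * 2 ^ (s - n) * c ^ s * (1 + c * ‖ξ‖) ^ (-(s - n)) := by
  rcases eq_or_ne ξ 0 with rfl | hξ
  · have h0 : ‖m 0‖ ≤ 0 := by simpa using hlow 0 (by simp)
    rw [smul_zero, le_antisymm h0 (norm_nonneg _), mul_zero]
    positivity
  have hξ0 : 0 < ‖ξ‖ := norm_pos_iff.mpr hξ
  set t : ℝ := c * ‖ξ‖ with ht
  have ht0 : 0 < t := by positivity
  have hnorm : ‖c • ξ‖ = t := by rw [norm_smul, Real.norm_of_nonneg hc.le]
  have h1 : (1 + ‖ξ‖ ^ 2) ^ (-s / 2) ≤ c ^ s * t ^ (-s) := by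
    have e1 : c ^ s * t ^ (-s) = (‖ξ‖ ^ 2) ^ (-s / 2) := by
      rw [ht, Real.mul_rpow hc.le hξ0.le, ← mul_assoc, ← Real.rpow_add hc, add_neg_cancel,
        Real.rpow_zero, one_mul, ← Real.rpow_natCast, ← Real.rpow_mul hξ0.le]
      congr 1; push_cast; ring
    rw [e1]
    exact Real.rpow_le_rpow_of_nonpos (by positivity) (by linarith) (by linarith)
  have h2 : t ^ (-s) * ‖m (c • ξ)‖ ≤ C * 2 ^ (s - n) * (1 + t) ^ (-(s - n)) := by
    have hsn : 0 ≤ s - n := by linarith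
    rw [Real.rpow_neg (by positivity : 0 ≤ 1 + t), ← div_eq_mul_inv, le_div_iff₀ (by positivity)]
    rcases le_total t 1 with h | h
    · have hm := hlow (c • ξ) (by rw [hnorm]; exact h)
      rw [hnorm] at hm
      have e1 : t ^ (-s) * t ^ (l + 1) ≤ 1 := by
        rw [← Real.rpow_natCast, ← Real.rpow_add ht0]
        exact Real.rpow_le_one ht0.le h (by push_cast; linarith)
      have e2 : (1 + t) ^ (s - n) ≤ 2 ^ (s - n) :=
        Real.rpow_le_rpow (by positivity) (by linarith) hsn
      calc t ^ (-s) * ‖m (c • ξ)‖ * (1 + t) ^ (s - n)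
          ≤ t ^ (-s) * (C * t ^ (l + 1)) * 2 ^ (s - n) := by gcongr
        _ = C * 2 ^ (s - n) * (t ^ (-s) * t ^ (l + 1)) := by ring
        _ ≤ C * 2 ^ (s - n) * 1 := by gcongr
        _ = _ := mul_one _
    · have hm := hhigh (c • ξ) (by rw [hnorm]; exact h)
      rw [hnorm] at hm
      have e1 : t ^ (-s) * t ^ n * t ^ (s - n) = 1 := by
        rw [← Real.rpow_natCast, ← Real.rpow_add ht0, ← Real.rpow_add ht0]
        rw [show -s + (n : ℝ) + (s - n) = 0 by ring, Real.rpow_zero]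
      have e2 : (1 + t) ^ (s - n) ≤ 2 ^ (s - n) * t ^ (s - n) := by
        rw [← Real.mul_rpow (by norm_num) ht0.le]
        exact Real.rpow_le_rpow (by positivity) (by linarith) hsn
      calc t ^ (-s) * ‖m (c • ξ)‖ * (1 + t) ^ (s - n)
          ≤ t ^ (-s) * (C * t ^ n) * (2 ^ (s - n) * t ^ (s - n)) := by gcongr
        _ = C * 2 ^ (s - n) * (t ^ (-s) * t ^ n * t ^ (s - n)) := by ring
        _ = _ := by rw [e1, mul_one]
  calc (1 + ‖ξ‖ ^ 2) ^ (-s / 2) * ‖m (c • ξ)‖ ≤ c ^ s * t ^ (-s) * ‖m (c • ξ)‖ := by gcongr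
    _ = c ^ s * (t ^ (-s) * ‖m (c • ξ)‖) := by ring
    _ ≤ c ^ s * (C * 2 ^ (s - n) * (1 + t) ^ (-(s - n))) := by gcongr
    _ = _ := by ring

/-- The Fourier transform `(1 + |ξ|²)^(-s/2) v` of an element of `H^s(ℝ^d)` whose Bessel potential
has Fourier transform `v`. -/
def besselWeight {d : ℕ} (s : ℝ) (v : Lp ℂ 2 (volume : Measure (EuclideanSpace ℝ (Fin d))))
    (ξ : EuclideanSpace ℝ (Fin d)) : ℂ :=
  (((1 + ‖ξ‖ ^ 2) ^ (-s / 2) : ℝ) : ℂ) * v ξ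

lemma norm_besselWeight {d : ℕ} (s : ℝ)
    (v : Lp ℂ 2 (volume : Measure (EuclideanSpace ℝ (Fin d)))) (ξ : EuclideanSpace ℝ (Fin d)) :
    ‖besselWeight s v ξ‖ = (1 + ‖ξ‖ ^ 2) ^ (-s / 2) * ‖v ξ‖ := by
  rw [besselWeight, norm_mul, Complex.norm_real, Real.norm_of_nonneg (by positivity)]

lemma aestronglyMeasurable_besselWeight {d : ℕ} (s : ℝ)
    (v : Lp ℂ 2 (volume : Measure (EuclideanSpace ℝ (Fin d)))) :
    AEStronglyMeasurable (besselWeight s v) volume := by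
  refine AEStronglyMeasurable.mul (Continuous.aestronglyMeasurable ?_) (Lp.aestronglyMeasurable v)
  refine Complex.continuous_ofReal.comp (Continuous.rpow_const (by fun_prop) fun ξ => Or.inl ?_)
  positivity

/-- A multiplier `p` of growth `|ξ|^n`, `n < s - d/2`, is integrable against the Fourier transform
of an `H^s` function. -/
lemma integral_multiplier_besselWeight_le {d n : ℕ} {s B : ℝ} (hs : (d : ℝ) / 2 + n < s)
    (v : Lp ℂ 2 (volume : Measure (EuclideanSpace ℝ (Fin d))))
    {p : EuclideanSpace ℝ (Fin d) → ℂ} (hp : Continuous p) (hB0 : 0 ≤ B)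
    (hpB : ∀ ξ, ‖p ξ‖ ≤ B * ‖ξ‖ ^ n) :
    Integrable (fun ξ => p ξ * besselWeight s v ξ) ∧
      ∫ ξ, ‖p ξ * besselWeight s v ξ‖ ≤ B * 2 ^ (s / 2) * (decayNorm d (s - n) * ‖v‖) := by
  have hs0 : 0 ≤ s := by
    have : (0 : ℝ) ≤ d / 2 + n := by positivity
    linarith
  obtain ⟨h1, h2⟩ := integral_norm_mul_decay_le (q := s - n) (by linarith) one_pos v
  simp only [one_mul, Real.one_rpow] at h1 h2
  have hB : ∀ ξ, ‖p ξ * besselWeight s v ξ‖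
      ≤ B * 2 ^ (s / 2) * (‖v ξ‖ * (1 + ‖ξ‖) ^ (-(s - n))) := fun ξ => by
    rw [norm_mul, norm_besselWeight]
    calc ‖p ξ‖ * ((1 + ‖ξ‖ ^ 2) ^ (-s / 2) * ‖v ξ‖)
        ≤ B * ‖ξ‖ ^ n * ((1 + ‖ξ‖ ^ 2) ^ (-s / 2) * ‖v ξ‖) := by gcongr; exact hpB ξ
      _ = B * ‖v ξ‖ * (‖ξ‖ ^ n * (1 + ‖ξ‖ ^ 2) ^ (-s / 2)) := by ring
      _ ≤ B * ‖v ξ‖ * (2 ^ (s / 2) * (1 + ‖ξ‖) ^ (-(s - n))) :=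
        mul_le_mul_of_nonneg_left (rpow_one_add_sq_mul_pow_le hs0 (norm_nonneg ξ) n)
          (by positivity)
      _ = _ := by ring
  have hint : Integrable (fun ξ => p ξ * besselWeight s v ξ) :=
    (h1.const_mul (B * 2 ^ (s / 2))).mono'
      (hp.aestronglyMeasurable.mul (aestronglyMeasurable_besselWeight s v))
      (Filter.Eventually.of_forall hB)
  refine ⟨hint, (integral_mono hint.norm (h1.const_mul _) hB).trans ?_⟩
  rw [integral_const_mul, mul_comm (decayNorm d _)]
  gcongr

/-- A dilated symbol that is small of order `l + 1 ≥ s` at low frequencies and grows like `|ζ|^n`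
at high ones costs a factor `c^(s - d/2)` against the Fourier transform of an `H^s` function. -/
lemma integral_symbol_besselWeight_le {d l n : ℕ} {s C c : ℝ} (hs : (d : ℝ) / 2 + n < s)
    (hsl : s ≤ l + 1) (hC : 0 ≤ C) (hc : 0 < c)
    (v : Lp ℂ 2 (volume : Measure (EuclideanSpace ℝ (Fin d))))
    {m : EuclideanSpace ℝ (Fin d) → ℂ} (hm : Continuous m)
    (hlow : ∀ ζ, ‖ζ‖ ≤ 1 → ‖m ζ‖ ≤ C * ‖ζ‖ ^ (l + 1))
    (hhigh : ∀ ζ, 1 ≤ ‖ζ‖ → ‖m ζ‖ ≤ C * ‖ζ‖ ^ n) :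
    Integrable (fun ξ => m (c • ξ) * besselWeight s v ξ) ∧
      ∫ ξ, ‖m (c • ξ) * besselWeight s v ξ‖ ≤
        C * 2 ^ (s - n) * decayNorm d (s - n) * c ^ (s - d / 2) * ‖v‖ := by
  have hd : (0 : ℝ) ≤ d / 2 := by positivity
  have hn : (0 : ℝ) ≤ n := by positivity
  obtain ⟨h1, h2⟩ := integral_norm_mul_decay_le (q := s - n) (by linarith) hc v
  have hB : ∀ ξ, ‖m (c • ξ) * besselWeight s v ξ‖
      ≤ C * 2 ^ (s - n) * c ^ s * (‖v ξ‖ * (1 + c * ‖ξ‖) ^ (-(s - n))) := fun ξ => by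
    rw [norm_mul, norm_besselWeight]
    have := rpow_one_add_sq_mul_symbol_le (by linarith) (by linarith) hsl hC hc hlow hhigh ξ
    calc ‖m (c • ξ)‖ * ((1 + ‖ξ‖ ^ 2) ^ (-s / 2) * ‖v ξ‖)
        = (1 + ‖ξ‖ ^ 2) ^ (-s / 2) * ‖m (c • ξ)‖ * ‖v ξ‖ := by ring
      _ ≤ C * 2 ^ (s - n) * c ^ s * (1 + c * ‖ξ‖) ^ (-(s - n)) * ‖v ξ‖ := by gcongr
      _ = _ := by ring
  have hint : Integrable (fun ξ => m (c • ξ) * besselWeight s v ξ) :=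
    (h1.const_mul (C * 2 ^ (s - n) * c ^ s)).mono'
      ((hm.comp (continuous_const_smul c)).aestronglyMeasurable.mul
        (aestronglyMeasurable_besselWeight s v))
      (Filter.Eventually.of_forall hB)
  refine ⟨hint, (integral_mono hint.norm (h1.const_mul _) hB).trans ?_⟩
  rw [integral_const_mul]
  calc C * 2 ^ (s - n) * c ^ s * ∫ ξ, ‖v ξ‖ * (1 + c * ‖ξ‖) ^ (-(s - n))
      ≤ C * 2 ^ (s - n) * c ^ s * (‖v‖ * (c ^ (-((d : ℝ) / 2)) * decayNorm d (s - n))) := by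
        gcongr
    _ = C * 2 ^ (s - n) * decayNorm d (s - n) * (c ^ s * c ^ (-((d : ℝ) / 2))) * ‖v‖ := by ring
    _ = _ := by rw [← Real.rpow_add hc, sub_eq_add_neg s ((d : ℝ) / 2)]

/-! ### Fourier representation of Sobolev functions and their derivatives -/

open FourierTransform in
lemma continuous_fourierInv {d : ℕ} {f : EuclideanSpace ℝ (Fin d) → ℂ} (hf : Integrable f) :
    Continuous (𝓕⁻ f : EuclideanSpace ℝ (Fin d) → ℂ) :=
  VectorFourier.fourierIntegral_continuous Real.continuous_fourierChar
    (L := -innerₗ (EuclideanSpace ℝ (Fin d)))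
    (by simpa using (continuous_inner (𝕜 := ℝ) (E := EuclideanSpace ℝ (Fin d))).fun_neg) hf

open FourierTransform ContDiff in
/-- An element of `H^s(ℝ^d)`, `s > d/2`, is almost everywhere the absolutely convergent inverse
Fourier integral of its Fourier transform. -/
lemma ae_eq_fourierInv_besselWeight {d : ℕ} {s : ℝ} (hs : (d : ℝ) / 2 < s)
    (U V : Lp ℂ 2 (volume : Measure (EuclideanSpace ℝ (Fin d))))
    (hUV : besselPotential (EuclideanSpace ℝ (Fin d)) ℂ s
        (U : 𝓢'(EuclideanSpace ℝ (Fin d), ℂ)) = (V : 𝓢'(EuclideanSpace ℝ (Fin d), ℂ))) :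
    (U : EuclideanSpace ℝ (Fin d) → ℂ) =ᵐ[volume]
      (𝓕⁻ (besselWeight s (𝓕 V)) : EuclideanSpace ℝ (Fin d) → ℂ) := by
  set W := besselWeight s (𝓕 V) with hW
  have hWint : Integrable W := by
    have := (integral_multiplier_besselWeight_le (n := 0) (B := 1) (by simpa using hs) (𝓕 V)
      (p := fun _ => 1) continuous_const zero_le_one (fun _ => by simp)).1
    simpa using this
  have hFU : 𝓕 (U : 𝓢'(EuclideanSpace ℝ (Fin d), ℂ)) =
      smulLeftCLM ℂ (fun x : EuclideanSpace ℝ (Fin d) => (((1 + ‖x‖ ^ 2) ^ (-s / 2) : ℝ) : ℂ))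
        ((𝓕 V : Lp ℂ 2 (volume : Measure (EuclideanSpace ℝ (Fin d)))) :
          𝓢'(EuclideanSpace ℝ (Fin d), ℂ)) := by
    rw [← Lp.fourier_toTemperedDistribution_eq, ← hUV,
      ← fourier_besselPotential_eq_smulLeftCLM_fourier_apply,
      besselPotential_besselPotential_apply, add_neg_cancel, besselPotential_zero]
    rfl
  have hcont := continuous_fourierInv hWint
  -- Both functions define the same tempered distribution: move the Fourier transform onto the test
  -- function, and back by Fubini's theorem.
  have htest : ∀ g : 𝓢(EuclideanSpace ℝ (Fin d), ℂ), ∫ x, g x • U x = ∫ x, g x • (𝓕⁻ W) x := by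
    intro g
    have h1 : (U : 𝓢'(EuclideanSpace ℝ (Fin d), ℂ)) g
        = (𝓕 (U : 𝓢'(EuclideanSpace ℝ (Fin d), ℂ))) (𝓕⁻ g) := by
      rw [TemperedDistribution.fourier_apply, fourier_fourierInv_eq]
    rw [Lp.toTemperedDistribution_apply, hFU, smulLeftCLM_apply_apply,
      Lp.toTemperedDistribution_apply] at h1
    rw [h1]
    have h2 : ∀ x, (SchwartzMap.smulLeftCLM ℂ
        (fun x : EuclideanSpace ℝ (Fin d) => (((1 + ‖x‖ ^ 2) ^ (-s / 2) : ℝ) : ℂ)) (𝓕⁻ g)) x •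
        (𝓕 V : Lp ℂ 2 (volume : Measure (EuclideanSpace ℝ (Fin d)))) x
        = (𝓕⁻ (g : EuclideanSpace ℝ (Fin d) → ℂ)) x • W x := by
      intro x
      rw [SchwartzMap.smulLeftCLM_apply_apply (by fun_prop), hW, besselWeight,
        SchwartzMap.fourierInv_coe]
      simp only [smul_eq_mul]
      ring
    simp only [h2]
    have h3 := VectorFourier.integral_bilin_fourierIntegral_eq_flip
      (ContinuousLinearMap.lsmul ℂ ℂ : ℂ →L[ℂ] ℂ →L[ℂ] ℂ) (μ := volume) (ν := volume)
      (L := -innerₗ (EuclideanSpace ℝ (Fin d))) Real.continuous_fourierChar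
      (by simpa using (continuous_inner (𝕜 := ℝ) (E := EuclideanSpace ℝ (Fin d))).fun_neg)
      (g.integrable (μ := volume)) hWint
    simp only [ContinuousLinearMap.lsmul_apply] at h3
    have hflip : (-innerₗ (EuclideanSpace ℝ (Fin d))).flip
        = -innerₗ (EuclideanSpace ℝ (Fin d)) := by
      ext x y
      simp [real_inner_comm]
    rw [hflip] at h3
    exact h3
  refine ae_eq_of_integral_contDiff_smul_eq ((Lp.memLp U).locallyIntegrable (by norm_num))
    hcont.locallyIntegrable fun g hg hgc => ?_
  have hg₁ : HasCompactSupport (Complex.ofRealCLM ∘ g) := hgc.comp_left rfl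
  have hg₂ : ContDiff ℝ ∞ (Complex.ofRealCLM ∘ g) := by fun_prop
  have := htest (hg₁.toSchwartzMap hg₂)
  simpa using this

/-- Iterated partial derivatives `∂_L`, along a list `L` of indices; the head of the list is the
outermost derivative. -/
def iterPartial {d : ℕ} {𝕜 : Type*} [RCLike 𝕜] (L : List (Fin d))
    (u : EuclideanSpace ℝ (Fin d) → 𝕜) : EuclideanSpace ℝ (Fin d) → 𝕜 :=
  L.foldr partialDeriv u

open FourierTransform in
lemma differentiable_fourierInv_and_partialDeriv {d : ℕ} {f : EuclideanSpace ℝ (Fin d) → ℂ}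
    (hf : Integrable f)
    (hf' : Integrable fun ξ => ‖ξ‖ * ‖f ξ‖) :
    Differentiable ℝ (𝓕⁻ f : EuclideanSpace ℝ (Fin d) → ℂ) ∧ ∀ k : Fin d,
      partialDeriv k (𝓕⁻ f : EuclideanSpace ℝ (Fin d) → ℂ)
        = 𝓕⁻ (fun ξ => (2 * Real.pi * Complex.I * (ξ k : ℂ)) * f ξ) := by
  have hg : Integrable fun ξ => f (-ξ) := hf.comp_neg
  have hg' : Integrable fun ξ => ‖ξ‖ * ‖f (-ξ)‖ := by simpa using hf'.comp_neg
  have hd := Real.hasFDerivAt_fourier hg hg'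
  rw [← Real.fourierInv_eq_fourier_comp_neg] at hd
  refine ⟨fun x => (hd x).differentiableAt, fun k => ?_⟩
  funext x
  rw [partialDeriv, (hd x).fderiv, Real.fourierInv_eq_fourier_comp_neg]
  have hint : Integrable (VectorFourier.fourierSMulRight (innerSL ℝ) fun ξ => f (-ξ)) := by
    refine (hg'.const_mul (2 * Real.pi * ‖innerSL ℝ (E := EuclideanSpace ℝ (Fin d))‖)).mono'
      (hg.aestronglyMeasurable.fourierSMulRight (L := innerSL ℝ))
      (Filter.Eventually.of_forall fun ξ => ?_)
    rw [← mul_assoc]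
    exact VectorFourier.norm_fourierSMulRight_le _ _ _
  rw [Real.fourier_continuousLinearMap_apply hint]
  refine congrFun (congrArg _ (funext fun ξ => ?_)) x
  have hk : innerSL ℝ ξ (EuclideanSpace.single k 1) = ξ k := by
    rw [innerSL_apply_apply, EuclideanSpace.inner_single_right]
    simp
  simp [hk, mul_assoc]

/-- The Fourier symbol of `∂_L`. -/
def partialSymbol {d : ℕ} (L : List (Fin d)) (ξ : EuclideanSpace ℝ (Fin d)) : ℂ :=
  (L.map fun k => (2 * Real.pi * Complex.I) * (ξ k : ℂ)).prod

lemma norm_partialSymbol_le {d : ℕ} (L : List (Fin d)) (ξ : EuclideanSpace ℝ (Fin d)) :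
    ‖partialSymbol L ξ‖ ≤ (2 * Real.pi) ^ L.length * ‖ξ‖ ^ L.length := by
  rw [← mul_pow]
  refine (norm_prod_list_le _ L ξ).trans (le_of_eq ?_)
  simp [abs_of_pos Real.pi_pos]

lemma continuous_partialSymbol {d : ℕ} (L : List (Fin d)) :
    Continuous (partialSymbol L) := continuous_list_prod_coord _ L

lemma integrable_partialSymbol_mul {d : ℕ} {s : ℝ} {L : List (Fin d)}
    (hs : (d : ℝ) / 2 + L.length < s)
    (v : Lp ℂ 2 (volume : Measure (EuclideanSpace ℝ (Fin d)))) :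
    Integrable (fun ξ => partialSymbol L ξ * besselWeight s v ξ) ∧
      ∫ ξ, ‖partialSymbol L ξ * besselWeight s v ξ‖ ≤
        (2 * Real.pi) ^ L.length * 2 ^ (s / 2) * (decayNorm d (s - L.length) * ‖v‖) :=
  integral_multiplier_besselWeight_le hs v (continuous_partialSymbol L)
    (by positivity) (norm_partialSymbol_le L)

open FourierTransform in
lemma differentiable_fourierInv_partialSymbol {d : ℕ} {s : ℝ} {L : List (Fin d)}
    (hs : (d : ℝ) / 2 + L.length + 1 < s)
    (v : Lp ℂ 2 (volume : Measure (EuclideanSpace ℝ (Fin d)))) :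
    Differentiable ℝ (𝓕⁻ (fun ξ => partialSymbol L ξ * besselWeight s v ξ) :
        EuclideanSpace ℝ (Fin d) → ℂ) ∧
      ∀ k, partialDeriv k (𝓕⁻ (fun ξ => partialSymbol L ξ * besselWeight s v ξ) :
          EuclideanSpace ℝ (Fin d) → ℂ)
        = 𝓕⁻ (fun ξ => partialSymbol (k :: L) ξ * besselWeight s v ξ) := by
  have h1 := (integral_multiplier_besselWeight_le (n := L.length + 1) (s := s)
    (p := fun ξ => (‖ξ‖ : ℂ) * partialSymbol L ξ) (by push_cast; linarith) v
    ((Complex.continuous_ofReal.comp continuous_norm).mul (continuous_partialSymbol L))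
    (B := (2 * Real.pi) ^ L.length) (by positivity) (fun ξ => by
      rw [norm_mul, Complex.norm_real, norm_norm]
      calc ‖ξ‖ * ‖partialSymbol L ξ‖ ≤ ‖ξ‖ * ((2 * Real.pi) ^ L.length * ‖ξ‖ ^ L.length) := by
            gcongr; exact norm_partialSymbol_le L ξ
        _ = _ := by ring)).1.norm
  have h2 : ∀ ξ, ‖(‖ξ‖ : ℂ) * partialSymbol L ξ * besselWeight s v ξ‖
      = ‖ξ‖ * ‖partialSymbol L ξ * besselWeight s v ξ‖ := fun ξ => by
    rw [mul_assoc, norm_mul, Complex.norm_real, norm_norm]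
  simp only [h2] at h1
  obtain ⟨h3, h4⟩ := differentiable_fourierInv_and_partialDeriv
    (integrable_partialSymbol_mul (L := L) (by linarith) v).1 h1
  refine ⟨h3, fun k => (h4 k).trans ?_⟩
  congr 1
  funext ξ
  rw [partialSymbol, partialSymbol, List.map_cons, List.prod_cons]
  ring

open FourierTransform in
lemma iterPartial_fourierInv {d : ℕ} {s : ℝ} {L : List (Fin d)}
    (hs : (d : ℝ) / 2 + L.length < s)
    (v : Lp ℂ 2 (volume : Measure (EuclideanSpace ℝ (Fin d)))) :
    iterPartial L (𝓕⁻ (besselWeight s v) : EuclideanSpace ℝ (Fin d) → ℂ)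
      = 𝓕⁻ (fun ξ => partialSymbol L ξ * besselWeight s v ξ) := by
  induction L with
  | nil => simp [iterPartial, partialSymbol]
  | cons k L ih =>
    rw [List.length_cons] at hs
    push_cast at hs
    have := ih (by linarith)
    rw [iterPartial, List.foldr_cons]
    change partialDeriv k (iterPartial L _) = _
    rw [this]
    exact (differentiable_fourierInv_partialSymbol (by linarith) v).2 k

open FourierTransform in
lemma differentiable_iterPartial_fourierInv {d : ℕ} {s : ℝ} {L : List (Fin d)}
    (hs : (d : ℝ) / 2 + L.length + 1 < s)
    (v : Lp ℂ 2 (volume : Measure (EuclideanSpace ℝ (Fin d)))) :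
    Differentiable ℝ
      (iterPartial L (𝓕⁻ (besselWeight s v) : EuclideanSpace ℝ (Fin d) → ℂ)) := by
  rw [iterPartial_fourierInv (by linarith)]
  exact (differentiable_fourierInv_partialSymbol hs v).1

open FourierTransform in
/-- Uniform bound for the derivatives of order less than `s - d/2` (Sobolev embedding). -/
lemma norm_iterPartial_fourierInv_le {d : ℕ} {s : ℝ} {L : List (Fin d)}
    (hs : (d : ℝ) / 2 + L.length < s)
    (v : Lp ℂ 2 (volume : Measure (EuclideanSpace ℝ (Fin d)))) (y : EuclideanSpace ℝ (Fin d)) :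
    ‖iterPartial L (𝓕⁻ (besselWeight s v) : EuclideanSpace ℝ (Fin d) → ℂ) y‖ ≤
      (2 * Real.pi) ^ L.length * 2 ^ (s / 2) * decayNorm d (s - L.length) * ‖v‖ := by
  rw [iterPartial_fourierInv hs, Real.fourierInv_eq, mul_assoc _ (decayNorm d _)]
  refine (norm_integral_le_integral_norm _).trans ?_
  simp only [Circle.norm_smul]
  exact (integrable_partialSymbol_mul hs v).2

open FourierTransform in
/-- If `u` vanishes at the points `y + ρ z i`, then `ρ^|L| ∂_L u(y)` is a Fourier integral with the
error symbol of any weights attached to these points. -/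
lemma norm_iterPartial_le_integral_errorSymbol {d : ℕ} {ι : Type*} [Fintype ι] {s ρ : ℝ}
    {L : List (Fin d)} (hs : (d : ℝ) / 2 + L.length < s)
    (v : Lp ℂ 2 (volume : Measure (EuclideanSpace ℝ (Fin d)))) (a : ι → ℝ)
    (z : ι → EuclideanSpace ℝ (Fin d)) (y : EuclideanSpace ℝ (Fin d)) (hρ : 0 < ρ)
    (hzero : ∀ i, (𝓕⁻ (besselWeight s v) : EuclideanSpace ℝ (Fin d) → ℂ) (y + ρ • z i) = 0) :
    ρ ^ L.length * ‖iterPartial L (𝓕⁻ (besselWeight s v) : EuclideanSpace ℝ (Fin d) → ℂ) y‖ ≤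
      ∫ ξ, ‖errorSymbol L a z ((2 * Real.pi * ρ) • ξ) * besselWeight s v ξ‖ := by
  set W := besselWeight s v with hW
  have hn : (0 : ℝ) ≤ L.length := by positivity
  have hWint : Integrable W := by
    simpa [partialSymbol] using
      (integrable_partialSymbol_mul (L := ([] : List (Fin d))) (by simp; linarith) v).1
  have hexp : ∀ x : EuclideanSpace ℝ (Fin d), Integrable fun ξ =>
      Complex.exp ((2 * Real.pi * inner ℝ ξ x : ℝ) * Complex.I) * W ξ := fun x => by
    refine hWint.bdd_mul (c := 1) (Continuous.aestronglyMeasurable (by fun_prop))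
      (Filter.Eventually.of_forall fun ξ => ?_)
    rw [Complex.norm_exp_ofReal_mul_I]
  have hsym : Integrable fun ξ => Complex.exp ((2 * Real.pi * inner ℝ ξ y : ℝ) * Complex.I)
      * (partialSymbol L ξ * W ξ) := by
    refine (integrable_partialSymbol_mul hs v).1.bdd_mul (c := 1)
      (Continuous.aestronglyMeasurable (by fun_prop)) (Filter.Eventually.of_forall fun ξ => ?_)
    rw [Complex.norm_exp_ofReal_mul_I]
  have hval : ∀ i, ∫ ξ, Complex.exp ((2 * Real.pi * inner ℝ ξ (y + ρ • z i) : ℝ) * Complex.I)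
      * W ξ = 0 := fun i => by
    rw [← hzero i, Real.fourierInv_eq']
    rfl
  have hscale : ∀ ξ : EuclideanSpace ℝ (Fin d), (ρ : ℂ) ^ L.length * partialSymbol L ξ
      = (L.map fun k => Complex.I * ((((2 * Real.pi * ρ) • ξ) k : ℝ) : ℂ)).prod := fun ξ => by
    rw [partialSymbol]
    clear hs hsym hn
    induction L with
    | nil => simp
    | cons k L ih =>
      rw [List.map_cons, List.prod_cons, List.map_cons, List.prod_cons, ← ih, List.length_cons,
        PiLp.smul_apply, smul_eq_mul, pow_succ]
      push_cast
      ring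
  have hmain : (ρ : ℂ) ^ L.length * iterPartial L (𝓕⁻ W : EuclideanSpace ℝ (Fin d) → ℂ) y
      = ∫ ξ, Complex.exp ((2 * Real.pi * inner ℝ ξ y : ℝ) * Complex.I) *
          (errorSymbol L a z ((2 * Real.pi * ρ) • ξ) * W ξ) := by
    have h1 : ∀ ξ, Complex.exp ((2 * Real.pi * inner ℝ ξ y : ℝ) * Complex.I) *
          (errorSymbol L a z ((2 * Real.pi * ρ) • ξ) * W ξ)
        = (ρ : ℂ) ^ L.length * (Complex.exp ((2 * Real.pi * inner ℝ ξ y : ℝ) * Complex.I)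
          * (partialSymbol L ξ * W ξ)) - ∑ i, (a i : ℂ) *
            (Complex.exp ((2 * Real.pi * inner ℝ ξ (y + ρ • z i) : ℝ) * Complex.I) * W ξ) := by
      intro ξ
      rw [errorSymbol, ← hscale, sub_mul, mul_sub, Finset.sum_mul, Finset.mul_sum]
      congr 1
      · ring
      · refine Finset.sum_congr rfl fun i _ => ?_
        rw [inner_add_right, real_inner_smul_right, real_inner_smul_left]
        have h2 : ((2 * Real.pi * (inner ℝ ξ y + ρ * inner ℝ ξ (z i)) : ℝ) : ℂ) * Complex.I
            = ((2 * Real.pi * inner ℝ ξ y : ℝ) : ℂ) * Complex.I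
              + ((2 * Real.pi * ρ * inner ℝ ξ (z i) : ℝ) : ℂ) * Complex.I := by
          push_cast; ring
        rw [h2, Complex.exp_add]
        ring
    simp only [h1]
    rw [integral_sub (hsym.const_mul _) (integrable_finsetSum _ fun i _ => (hexp _).const_mul _),
      integral_finsetSum _ fun i _ => (hexp _).const_mul _]
    simp only [integral_const_mul, hval, mul_zero, Finset.sum_const_zero, sub_zero]
    rw [iterPartial_fourierInv hs, Real.fourierInv_eq']
    rfl
  have hρn : ρ ^ L.length = ‖(ρ : ℂ) ^ L.length‖ := by
    rw [norm_pow, Complex.norm_real, Real.norm_of_nonneg hρ.le]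
  rw [hρn, ← norm_mul, hmain]
  refine (norm_integral_le_integral_norm _).trans (le_of_eq ?_)
  refine integral_congr_ae (Filter.Eventually.of_forall fun ξ => ?_)
  simp only
  rw [norm_mul, Complex.norm_exp_ofReal_mul_I, one_mul]

/-! ### The sampling inequality -/

/-- Near every point `x` of `Ω` there are balls in `Ω` of radius and distance from `x`
proportional to `ρ`, for every small `ρ`. -/
lemma InteriorCone.exists_ball {d : ℕ} {Ω : Set (EuclideanSpace ℝ (Fin d))}
    (hΩ : InteriorCone Ω) :
    ∃ r : ℝ, 0 < r ∧ ∃ c : ℝ, 0 < c ∧ ∀ x ∈ Ω, ∃ w : EuclideanSpace ℝ (Fin d), ‖w‖ ≤ 1 ∧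
      ∀ ρ ∈ Set.Ioc 0 r, ∀ g : EuclideanSpace ℝ (Fin d), ‖g‖ ≤ c → x + ρ • (w + g) ∈ Ω := by
  obtain ⟨r, hr, θ, ⟨hθ0, hθ1⟩, h⟩ := hΩ
  have hcos0 : 0 < Real.cos θ := Real.cos_pos_of_mem_Ioo ⟨by linarith, hθ1⟩
  have hcos1 : Real.cos θ < 1 := by
    rw [← Real.cos_zero]
    exact Real.cos_lt_cos_of_nonneg_of_le_pi_div_two le_rfl hθ1.le hθ0
  -- With `(1/2 - c) / (1/2 + c) = cos θ`, every `p` in the ball of radius `c` around `ξ / 2` has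
  -- `⟪p, ξ⟫ ≥ 1/2 - c = cos θ * (1/2 + c) ≥ cos θ * ‖p‖`, so it lies in the cone.
  set c : ℝ := (1 - Real.cos θ) / (2 * (1 + Real.cos θ)) with hc
  have hc0 : 0 < c := by rw [hc]; apply div_pos <;> linarith
  have hceq : Real.cos θ * (1 / 2 + c) = 1 / 2 - c := by rw [hc]; field_simp; ring
  have hc2 : 0 < 1 / 2 - c := by rw [← hceq]; positivity
  refine ⟨r, hr, c, hc0, fun x hx => ?_⟩
  obtain ⟨ξ, hξ, hcone⟩ := h x hx
  have hhalf : ‖(1 / 2 : ℝ) • ξ‖ = 1 / 2 := by rw [norm_smul, hξ]; norm_num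
  refine ⟨(1 / 2 : ℝ) • ξ, by rw [hhalf]; norm_num, fun ρ hρ g hg => ?_⟩
  set p : EuclideanSpace ℝ (Fin d) := (1 / 2 : ℝ) • ξ + g with hp
  have hpn : ‖p‖ ≤ 1 / 2 + c := (norm_add_le _ _).trans (by rw [hhalf]; gcongr)
  have hpi : 1 / 2 - c ≤ inner ℝ p ξ := by
    have h1 : |inner ℝ g ξ| ≤ c :=
      (abs_real_inner_le_norm _ _).trans (by rw [hξ, mul_one]; exact hg)
    rw [hp, inner_add_left, real_inner_smul_left, real_inner_self_eq_norm_sq, hξ]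
    linarith [neg_abs_le (inner ℝ g ξ)]
  have hp0 : 0 < ‖p‖ := by
    have h1 : inner ℝ p ξ ≤ ‖p‖ := (real_inner_le_norm _ _).trans (by rw [hξ, mul_one])
    linarith
  have hmem := hcone (‖p‖⁻¹ • p) (by rw [norm_smul, norm_inv, norm_norm, inv_mul_cancel₀ hp0.ne'])
    (by
      rw [real_inner_smul_left, ← div_eq_inv_mul, le_div_iff₀ hp0]
      calc Real.cos θ * ‖p‖ ≤ Real.cos θ * (1 / 2 + c) := by gcongr
        _ ≤ _ := by rw [hceq]; exact hpi)
    (ρ * ‖p‖) ⟨by have := hρ.1; positivity, by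
      calc ρ * ‖p‖ ≤ r * 1 := by
            gcongr
            · exact hρ.2
            · linarith
        _ = r := mul_one r⟩
  rwa [smul_smul, mul_assoc, mul_inv_cancel₀ hp0.ne', mul_one] at hmem

open FourierTransform in
/-- Sampling inequality: an `H^s` function that vanishes on a set which is `δ`-dense in `Ω` is, with
its derivatives `∂_L` of order less than `s - d/2`, of size `δ^(s - d/2 - |L|)` on `Ω`. -/
lemma exists_sampling_bound {d : ℕ} {Ω : Set (EuclideanSpace ℝ (Fin d))} (hΩ : InteriorCone Ω)
    {s : ℝ} {L : List (Fin d)} (hs : (d : ℝ) / 2 + L.length < s) :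
    ∃ δ₀ > 0, ∃ C : ℝ, 0 ≤ C ∧ ∀ δ ∈ Set.Ioc 0 δ₀, ∀ X : Set (EuclideanSpace ℝ (Fin d)),
      (∀ y ∈ Ω, ∃ p ∈ X, dist y p ≤ δ) →
      ∀ v : Lp ℂ 2 (volume : Measure (EuclideanSpace ℝ (Fin d))),
      (∀ p ∈ X, (𝓕⁻ (besselWeight s v) : EuclideanSpace ℝ (Fin d) → ℂ) p = 0) → ∀ y ∈ Ω,
        ‖iterPartial L (𝓕⁻ (besselWeight s v) : EuclideanSpace ℝ (Fin d) → ℂ) y‖ ≤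
          C * ‖v‖ * δ ^ (s - d / 2 - L.length) := by
  obtain ⟨r, hr, c, hc, hball⟩ := hΩ.exists_ball
  set l := ⌈s⌉₊ with hl
  have hsl : s ≤ l := Nat.le_ceil s
  have hLl : L.length ≤ l := by
    have : (L.length : ℝ) ≤ l := by
      have : (0 : ℝ) ≤ d / 2 := by positivity
      linarith
    exact_mod_cast this
  obtain ⟨g, hg, ε, hε, hε1, A, hA0, hweights⟩ := exists_stable_weights d l L hc
  set R : ℝ := 2 + c with hR
  set B : ℝ := max (A * (R ^ (l + 1) * Real.exp R)) (1 + A) with hB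
  have hB0 : 0 ≤ B := le_max_of_le_right (by linarith)
  set q : ℝ := s - d / 2 - L.length with hq
  set D : ℝ := B * 2 ^ (s - L.length) * decayNorm d (s - L.length) * (2 * Real.pi) ^ (s - d / 2)
    with hD
  have hD0 : 0 ≤ D := by
    have := decayNorm_nonneg d (s - L.length)
    positivity
  refine ⟨ε * r, by positivity, D * (ε ^ q)⁻¹, by positivity, ?_⟩
  intro δ hδ X hX v hzero y hy
  obtain ⟨w, hw, hwΩ⟩ := hball y hy
  -- The scale at which the perturbation `δ` of the nodes becomes the admissible `ε`.
  set ρ : ℝ := δ / ε with hρ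
  have hρ0 : 0 < ρ := div_pos hδ.1 hε
  have hρr : ρ ≤ r := by rw [hρ, div_le_iff₀ hε, mul_comm]; exact hδ.2
  have hpts : ∀ i, ∃ p ∈ X, dist (y + ρ • (w + g i)) p ≤ δ := fun i =>
    hX _ (hwΩ ρ ⟨hρ0, hρr⟩ (g i) (hg i))
  choose p hpX hp using hpts
  set z := fun i => ρ⁻¹ • (p i - y) with hz
  have hyz : ∀ i, y + ρ • z i = p i := fun i => by
    rw [hz]
    simp only
    rw [smul_smul, mul_inv_cancel₀ hρ0.ne', one_smul, add_sub_cancel]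
  have hzd : ∀ i, dist (z i) (w + g i) ≤ ε := fun i => by
    have h1 : dist (y + ρ • (w + g i)) (y + ρ • z i) = ρ * dist (w + g i) (z i) := by
      rw [dist_add_left, dist_smul₀, Real.norm_of_nonneg hρ0.le]
    have h2 := hp i
    rw [← hyz i, h1, dist_comm, mul_comm, ← le_div_iff₀ hρ0] at h2
    refine h2.trans (le_of_eq ?_)
    rw [hρ]
    have := hδ.1.ne'
    field_simp
  have hzR : ∀ i, ‖z i‖ ≤ R := fun i => by
    have h1 : ‖z i‖ ≤ ‖z i - (w + g i)‖ + ‖w + g i‖ := by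
      simpa using norm_add_le (z i - (w + g i)) (w + g i)
    have h2 : ‖z i - (w + g i)‖ ≤ ε := by rw [← dist_eq_norm]; exact hzd i
    have h3 := norm_add_le w (g i)
    have h4 := hg i
    rw [hR]
    linarith
  obtain ⟨a, haA, ha⟩ := hweights w hw z hzd
  have h1 := norm_iterPartial_le_integral_errorSymbol hs v a z y hρ0
    (fun i => by rw [hyz]; exact hzero _ (hpX i))
  have h2 := (integral_symbol_besselWeight_le (l := l) (C := B) (c := 2 * Real.pi * ρ) hs
    (by linarith) hB0 (by positivity) v (continuous_errorSymbol L a z)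
    (fun ζ hζ => (norm_errorSymbol_le_of_le_one hLl haA hzR ha hζ).trans
      (by gcongr; exact le_max_left _ _))
    (fun ζ hζ => (norm_errorSymbol_le_of_one_le L haA z hζ).trans
      (by gcongr; exact le_max_right _ _))).2
  have h3 := h1.trans h2
  have hρq : ρ ^ (s - d / 2) = ρ ^ L.length * ρ ^ q := by
    rw [← Real.rpow_natCast, ← Real.rpow_add hρ0]
    congr 1; rw [hq]; ring
  rw [Real.mul_rpow (by positivity) hρ0.le, hρq] at h3
  have h4 : ρ ^ L.length * ‖iterPartial L
      (𝓕⁻ (besselWeight s v) : EuclideanSpace ℝ (Fin d) → ℂ) y‖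
      ≤ ρ ^ L.length * (D * ρ ^ q * ‖v‖) := h3.trans (le_of_eq (by rw [hD]; ring))
  refine (le_of_mul_le_mul_left h4 (by positivity)).trans (le_of_eq ?_)
  rw [hρ, Real.div_rpow hδ.1.le hε.le]
  ring

lemma iInf_dist_le_diam {d N : ℕ} {Ω : Set (EuclideanSpace ℝ (Fin d))}
    (hΩ : Bornology.IsBounded Ω) (x : Fin N → Ω) (y : Ω) :
    ⨅ i, dist y (x i) ≤ Metric.diam Ω := by
  rcases N.eq_zero_or_pos with rfl | hN
  · rw [Real.iInf_of_isEmpty]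
    exact Metric.diam_nonneg
  refine (ciInf_le ⟨0, ?_⟩ (⟨0, hN⟩ : Fin N)).trans
    (Metric.dist_le_diam_of_mem hΩ y.2 (x ⟨0, hN⟩).2)
  rintro _ ⟨i, rfl⟩
  exact dist_nonneg

lemma fillDist_le_diam {d N : ℕ} {Ω : Set (EuclideanSpace ℝ (Fin d))}
    (hΩ : Bornology.IsBounded Ω) (x : Fin N → Ω) : fillDist Ω x ≤ Metric.diam Ω :=
  Real.iSup_le (iInf_dist_le_diam hΩ x) Metric.diam_nonneg

lemma fillDist_nonneg {d N : ℕ} {Ω : Set (EuclideanSpace ℝ (Fin d))} (x : Fin N → Ω) :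
    0 ≤ fillDist Ω x :=
  Real.iSup_nonneg fun _ => Real.iInf_nonneg fun _ => dist_nonneg

lemma exists_dist_le_fillDist {d N : ℕ} {Ω : Set (EuclideanSpace ℝ (Fin d))}
    (hΩ : Bornology.IsBounded Ω) (hN : 0 < N) (x : Fin N → Ω) (y : Ω) :
    ∃ i, dist y (x i) ≤ fillDist Ω x := by
  have : Nonempty (Fin N) := ⟨⟨0, hN⟩⟩
  obtain ⟨i, hi⟩ := exists_eq_ciInf_of_finite (f := fun i => dist y (x i))
  have hbdd : BddAbove (Set.range fun y : Ω => ⨅ i, dist y (x i)) :=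
    ⟨Metric.diam Ω, Set.forall_mem_range.mpr (iInf_dist_le_diam hΩ x)⟩
  exact ⟨i, hi.le.trans (le_ciSup hbdd y)⟩

open FourierTransform in
/-- The sampling inequality in terms of the fill distance, with no restriction on its size. -/
lemma exists_fillDist_bound {d : ℕ} {Ω : Set (EuclideanSpace ℝ (Fin d))}
    (hbdd : Bornology.IsBounded Ω) (hΩ : InteriorCone Ω)
    {s : ℝ} {L : List (Fin d)} (hs : (d : ℝ) / 2 + L.length < s) :
    ∃ C : ℝ, 0 ≤ C ∧ ∀ N : ℕ, 0 < N → ∀ x : Fin N → Ω,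
      ∀ v : Lp ℂ 2 (volume : Measure (EuclideanSpace ℝ (Fin d))),
      (∀ i, (𝓕⁻ (besselWeight s v) : EuclideanSpace ℝ (Fin d) → ℂ) (x i) = 0) → ∀ y ∈ Ω,
        ‖iterPartial L (𝓕⁻ (besselWeight s v) : EuclideanSpace ℝ (Fin d) → ℂ) y‖ ≤
          C * ‖v‖ * fillDist Ω x ^ (s - d / 2 - L.length) := by
  obtain ⟨δ₀, hδ₀, C, hC, hsamp⟩ := exists_sampling_bound hΩ hs
  set q : ℝ := s - d / 2 - L.length with hq
  have hq0 : 0 < q := by rw [hq]; linarith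
  set D : ℝ := (2 * Real.pi) ^ L.length * 2 ^ (s / 2) * decayNorm d (s - L.length) with hD
  have hD0 : 0 ≤ D := by
    have := decayNorm_nonneg d (s - L.length)
    positivity
  refine ⟨C + D * (δ₀ ^ q)⁻¹, by positivity, fun N hN x v hv y hy => ?_⟩
  have hf0 := fillDist_nonneg x
  rcases lt_or_ge (fillDist Ω x) δ₀ with hlt | hge
  · -- The bound holds for every `δ` slightly above the fill distance, which might be zero; pass to
    -- the limit.
    have h1 : ∀ δ ∈ Set.Ioc (fillDist Ω x) δ₀, ‖iterPartial L
        (𝓕⁻ (besselWeight s v) : EuclideanSpace ℝ (Fin d) → ℂ) y‖ ≤ C * ‖v‖ * δ ^ q := by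
      intro δ hδ
      refine hsamp δ ⟨hf0.trans_lt hδ.1, hδ.2⟩ (Set.range fun i => (x i : EuclideanSpace ℝ (Fin d)))
        (fun y' hy' => ?_) v ?_ y hy
      · obtain ⟨i, hi⟩ := exists_dist_le_fillDist hbdd hN x ⟨y', hy'⟩
        exact ⟨x i, ⟨i, rfl⟩, hi.trans hδ.1.le⟩
      · rintro _ ⟨i, rfl⟩
        exact hv i
    have h2 : Filter.Tendsto (fun δ : ℝ => C * ‖v‖ * δ ^ q) (nhdsWithin (fillDist Ω x)
        (Set.Ioi (fillDist Ω x))) (nhds (C * ‖v‖ * fillDist Ω x ^ q)) :=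
      (((Real.continuousAt_rpow_const _ _ (Or.inr hq0.le)).tendsto).const_mul _).mono_left
        nhdsWithin_le_nhds
    have h3 := ge_of_tendsto h2 (Filter.mem_of_superset (Ioc_mem_nhdsGT hlt) h1)
    refine h3.trans ?_
    gcongr
    have : 0 ≤ D * (δ₀ ^ q)⁻¹ := by positivity
    linarith
  · -- For a fill distance bounded below, the Sobolev embedding suffices.
    refine (norm_iterPartial_fourierInv_le hs v y).trans ?_
    have h1 : δ₀ ^ q ≤ fillDist Ω x ^ q := Real.rpow_le_rpow hδ₀.le hge hq0.le
    calc D * ‖v‖ = D * (δ₀ ^ q)⁻¹ * ‖v‖ * δ₀ ^ q := by field_simp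
      _ ≤ (C + D * (δ₀ ^ q)⁻¹) * ‖v‖ * fillDist Ω x ^ q := by
        gcongr
        linarith

/-! ### Derivatives of elements of the native space -/

lemma map_complex_map_complex {𝕜 : Type*} [RCLike 𝕜] (z : 𝕜) :
    RCLike.map ℂ 𝕜 (RCLike.map 𝕜 ℂ z) = z := by
  simp [RCLike.map_apply]

lemma norm_map_complex_le {𝕜 : Type*} [RCLike 𝕜] (z : ℂ) : ‖RCLike.map ℂ 𝕜 z‖ ≤ ‖z‖ := by
  refine le_of_sq_le_sq ?_ (norm_nonneg _)
  rw [RCLike.norm_sq_eq_def, RCLike.norm_sq_eq_def (K := ℂ)]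
  rcases RCLike.I_eq_zero_or_im_I_eq_one (K := 𝕜) with h | h
  · simp [RCLike.map_apply, h]
    nlinarith [mul_self_nonneg z.im]
  · simp [RCLike.map_apply, h]

section NativeSpace

variable {𝕜 : Type*} [RCLike 𝕜] {d : ℕ} {Ω : Set (EuclideanSpace ℝ (Fin d))}
  {H : Type*} [NormedAddCommGroup H] [InnerProductSpace 𝕜 H] [RKHS 𝕜 H Ω 𝕜]

lemma ext_apply (u : Ω → 𝕜) (y : Ω) : ext u (y : EuclideanSpace ℝ (Fin d)) = u y :=
  Subtype.val_injective.extend_apply u 0 y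

open FourierTransform in
/-- Elements of the native space of an `s`-smooth kernel are given on `Ω` by Fourier integrals. -/
lemma IsSmoothKernel.exists_fourierInv {s : ℝ} (hs : (d : ℝ) / 2 < s)
    (hH : IsSmoothKernel H s) :
    ∃ M : ℝ, 0 ≤ M ∧ ∀ h : H, ∃ v : Lp ℂ 2 (volume : Measure (EuclideanSpace ℝ (Fin d))),
      ‖v‖ ≤ M * ‖h‖ ∧ ∀ x : Ω,
        (𝓕⁻ (besselWeight s v) : EuclideanSpace ℝ (Fin d) → ℂ) x = RCLike.map 𝕜 ℂ (h x) := by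
  obtain ⟨M, hM⟩ := hH
  refine ⟨|M|, abs_nonneg _, fun h => ?_⟩
  obtain ⟨u, U, V, hu, huU, hUV, hV, hx⟩ := hM h
  refine ⟨𝓕 V, ?_, fun x => ?_⟩
  · rw [Lp.norm_fourier_eq]
    exact hV.trans (by gcongr; exact le_abs_self M)
  · have hint : Integrable (besselWeight s (𝓕 V)) := by
      simpa [partialSymbol] using (integrable_partialSymbol_mul (L := ([] : List (Fin d)))
        (by simpa using hs) (𝓕 V)).1
    have hcont := continuous_fourierInv hint
    have := (hu.ae_eq_iff_eq volume hcont).mp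
      (huU.trans (ae_eq_fourierInv_besselWeight hs U V hUV))
    rw [← hx, this]

lemma partialDeriv_congr {k : Fin d} {u v : EuclideanSpace ℝ (Fin d) → 𝕜} (hΩ : IsOpen Ω)
    (h : Set.EqOn u v Ω) : Set.EqOn (partialDeriv k u) (partialDeriv k v) Ω := fun y hy => by
  rw [partialDeriv, partialDeriv,
    (Filter.eventuallyEq_of_mem (hΩ.mem_nhds hy) h).fderiv_eq]

lemma partialDeriv_map {k : Fin d} {u : EuclideanSpace ℝ (Fin d) → ℂ}
    {y : EuclideanSpace ℝ (Fin d)} (hu : DifferentiableAt ℝ u y) :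
    partialDeriv k (fun x => RCLike.map ℂ 𝕜 (u x)) y = RCLike.map ℂ 𝕜 (partialDeriv k u y) := by
  have := ((RCLike.map ℂ 𝕜).hasFDerivAt.comp y hu.hasFDerivAt).fderiv
  rw [partialDeriv, partialDeriv]
  change (fderiv ℝ ((RCLike.map ℂ 𝕜) ∘ u) y) _ = _
  rw [this]
  rfl

open FourierTransform in
lemma iterPartial_ext_eqOn {s : ℝ} {L : List (Fin d)} (hs : (d : ℝ) / 2 + L.length < s)
    (hΩ : IsOpen Ω) {h : Ω → 𝕜} {v : Lp ℂ 2 (volume : Measure (EuclideanSpace ℝ (Fin d)))}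
    (hv : ∀ x : Ω, (𝓕⁻ (besselWeight s v) : EuclideanSpace ℝ (Fin d) → ℂ) x
      = RCLike.map 𝕜 ℂ (h x)) :
    Set.EqOn (iterPartial L (ext h)) (fun y => RCLike.map ℂ 𝕜 (iterPartial L
      (𝓕⁻ (besselWeight s v) : EuclideanSpace ℝ (Fin d) → ℂ) y)) Ω := by
  induction L with
  | nil =>
    intro y hy
    simp only [iterPartial, List.foldr_nil]
    rw [ext_apply h ⟨y, hy⟩, hv ⟨y, hy⟩, map_complex_map_complex]
  | cons k L ih =>
    rw [List.length_cons] at hs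
    push_cast at hs
    intro y hy
    refine (partialDeriv_congr (k := k) hΩ (ih (by linarith)) hy).trans ?_
    exact partialDeriv_map (differentiable_iterPartial_fourierInv (by linarith) v y)

lemma differentiableAt_iterPartial_ext {s : ℝ} {L : List (Fin d)}
    (hs : (d : ℝ) / 2 + L.length + 1 < s) (hΩ : IsOpen Ω) (hH : IsSmoothKernel H s)
    (h : H) {y : EuclideanSpace ℝ (Fin d)} (hy : y ∈ Ω) :
    DifferentiableAt ℝ (iterPartial L (ext h)) y := by
  have hL : (0 : ℝ) ≤ L.length := by positivity
  obtain ⟨M, -, hM⟩ := hH.exists_fourierInv (by linarith)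
  obtain ⟨v, -, hv⟩ := hM h
  have h1 := (RCLike.map ℂ 𝕜).differentiableAt.comp y
    (differentiable_iterPartial_fourierInv hs v y)
  exact h1.congr_of_eventuallyEq (Filter.eventuallyEq_of_mem (hΩ.mem_nhds hy)
    (iterPartial_ext_eqOn (by linarith) hΩ hv))

lemma iterPartial_ext_add {s : ℝ} {L : List (Fin d)} (hs : (d : ℝ) / 2 + L.length < s)
    (hΩ : IsOpen Ω) (hH : IsSmoothKernel H s) (f g : H) :
    Set.EqOn (iterPartial L (ext ⇑(f + g)))
      (fun y => iterPartial L (ext f) y + iterPartial L (ext g) y) Ω := by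
  induction L with
  | nil =>
    intro y hy
    simp only [iterPartial, List.foldr_nil]
    rw [ext_apply _ ⟨y, hy⟩, ext_apply _ ⟨y, hy⟩, ext_apply _ ⟨y, hy⟩, RKHS.coe_add]
    rfl
  | cons k L ih =>
    rw [List.length_cons] at hs
    push_cast at hs
    intro y hy
    refine (partialDeriv_congr (k := k) hΩ (ih (by linarith)) hy).trans ?_
    rw [partialDeriv, fderiv_fun_add
      (differentiableAt_iterPartial_ext (by linarith) hΩ hH f hy)
      (differentiableAt_iterPartial_ext (by linarith) hΩ hH g hy)]
    rfl

lemma iterPartial_ext_smul {s : ℝ} {L : List (Fin d)} (hs : (d : ℝ) / 2 + L.length < s)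
    (hΩ : IsOpen Ω) (hH : IsSmoothKernel H s) (c : 𝕜) (f : H) :
    Set.EqOn (iterPartial L (ext ⇑(c • f))) (fun y => c * iterPartial L (ext f) y) Ω := by
  induction L with
  | nil =>
    intro y hy
    simp only [iterPartial, List.foldr_nil]
    rw [ext_apply _ ⟨y, hy⟩, ext_apply _ ⟨y, hy⟩, RKHS.coe_smul]
    rfl
  | cons k L ih =>
    rw [List.length_cons] at hs
    push_cast at hs
    intro y hy
    refine (partialDeriv_congr (k := k) hΩ (ih (by linarith)) hy).trans ?_
    rw [partialDeriv, fderiv_const_mul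
      (differentiableAt_iterPartial_ext (by linarith) hΩ hH f hy)]
    rfl

/-- An element of the native space that vanishes at the data points is small, together with its
derivatives of order less than `s - d/2`. -/
lemma IsSmoothKernel.exists_iterPartial_bound {s : ℝ} {L : List (Fin d)}
    (hs : (d : ℝ) / 2 + L.length < s) (hΩ : IsOpen Ω) (hbdd : Bornology.IsBounded Ω)
    (hcone : InteriorCone Ω) (hH : IsSmoothKernel H s) :
    ∃ C : ℝ, 0 ≤ C ∧ ∀ N : ℕ, 0 < N → ∀ (x : Fin N → Ω) (e : H), (∀ i, e (x i) = 0) → ∀ y : Ω,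
      ‖iterPartial L (ext e) y‖ ≤ C * ‖e‖ * fillDist Ω x ^ (s - d / 2 - L.length) := by
  have hL : (0 : ℝ) ≤ L.length := by positivity
  obtain ⟨M, hM0, hM⟩ := hH.exists_fourierInv (by linarith)
  obtain ⟨C, hC0, hC⟩ := exists_fillDist_bound hbdd hcone hs
  refine ⟨C * M, by positivity, fun N hN x e he y => ?_⟩
  obtain ⟨v, hvn, hv⟩ := hM e
  rw [iterPartial_ext_eqOn hs hΩ hv y.2]
  refine (norm_map_complex_le _).trans ((hC N hN x v (fun i => ?_) y y.2).trans ?_)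
  · rw [hv, he, map_zero]
  · have := Real.rpow_nonneg (fillDist_nonneg x) (s - d / 2 - L.length)
    calc C * ‖v‖ * fillDist Ω x ^ (s - d / 2 - L.length)
        ≤ C * (M * ‖e‖) * fillDist Ω x ^ (s - d / 2 - L.length) := by gcongr
      _ = _ := by ring

/-- The native space embeds continuously into the bounded functions on `Ω`. In particular the
supremum that defines the condition number is finite. -/
lemma IsSmoothKernel.exists_norm_apply_le {s : ℝ} (hs : (d : ℝ) / 2 < s)
    (hH : IsSmoothKernel H s) : ∃ B : ℝ, ∀ (h : H) (y : Ω), ‖h y‖ ≤ B * ‖h‖ := by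
  obtain ⟨M, hM0, hM⟩ := hH.exists_fourierInv hs
  refine ⟨2 ^ (s / 2) * decayNorm d s * M, fun h y => ?_⟩
  obtain ⟨v, hvn, hv⟩ := hM h
  have h1 := norm_iterPartial_fourierInv_le (L := ([] : List (Fin d))) (by simpa using hs) v y
  simp only [iterPartial, List.foldr_nil, List.length_nil, pow_zero, one_mul, Nat.cast_zero,
    sub_zero] at h1
  rw [← map_complex_map_complex (h y), ← hv y]
  have := decayNorm_nonneg d s
  calc _ ≤ _ := norm_map_complex_le _
    _ ≤ _ := h1
    _ ≤ 2 ^ (s / 2) * decayNorm d s * (M * ‖h‖) := by gcongr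
    _ = _ := by ring

/-! ### The differential operator on the native space -/

/-- The differential operator `G · ∇u + (1/2) Tr[a ∇²u] - lam u` at a point of `Ω`. -/
def pdeOp {m : ℕ} (G : EuclideanSpace ℝ (Fin d) → EuclideanSpace ℝ (Fin d))
    (σ : EuclideanSpace ℝ (Fin d) → Matrix (Fin d) (Fin m) ℝ) (lam : 𝕜) (u : Ω → 𝕜) (y : Ω) : 𝕜 :=
  driftTerm G (ext u) y + diffusionTerm σ (ext u) y - lam * u y

lemma pdeOp_add {m : ℕ} {s : ℝ} (hs : (d : ℝ) / 2 + 2 < s) (hΩ : IsOpen Ω)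
    (hH : IsSmoothKernel H s) (G : EuclideanSpace ℝ (Fin d) → EuclideanSpace ℝ (Fin d))
    (σ : EuclideanSpace ℝ (Fin d) → Matrix (Fin d) (Fin m) ℝ) (lam : 𝕜) (f g : H) (y : Ω) :
    pdeOp G σ lam ⇑(f + g) y = pdeOp G σ lam f y + pdeOp G σ lam g y := by
  have h1 : ∀ r, partialDeriv r (ext ⇑(f + g)) y
      = partialDeriv r (ext f) y + partialDeriv r (ext g) y := fun r =>
    iterPartial_ext_add (L := [r]) (by simp; linarith) hΩ hH f g y.2
  have h2 : ∀ r q, partialDeriv r (partialDeriv q (ext ⇑(f + g))) y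
      = partialDeriv r (partialDeriv q (ext f)) y + partialDeriv r (partialDeriv q (ext g)) y :=
    fun r q => iterPartial_ext_add (L := [r, q]) (by simpa using hs) hΩ hH f g y.2
  have h0 : (f + g) y = f y + g y := by rw [RKHS.coe_add, Pi.add_apply]
  simp only [pdeOp, driftTerm, diffusionTerm, h0, h1, h2, mul_add, Finset.sum_add_distrib]
  ring

lemma pdeOp_smul {m : ℕ} {s : ℝ} (hs : (d : ℝ) / 2 + 2 < s) (hΩ : IsOpen Ω)
    (hH : IsSmoothKernel H s) (G : EuclideanSpace ℝ (Fin d) → EuclideanSpace ℝ (Fin d))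
    (σ : EuclideanSpace ℝ (Fin d) → Matrix (Fin d) (Fin m) ℝ) (lam c : 𝕜) (f : H) (y : Ω) :
    pdeOp G σ lam ⇑(c • f) y = c * pdeOp G σ lam f y := by
  have h1 : ∀ r, partialDeriv r (ext ⇑(c • f)) y = c * partialDeriv r (ext f) y := fun r =>
    iterPartial_ext_smul (L := [r]) (by simp; linarith) hΩ hH c f y.2
  have h2 : ∀ r q, partialDeriv r (partialDeriv q (ext ⇑(c • f))) y
      = c * partialDeriv r (partialDeriv q (ext f)) y :=
    fun r q => iterPartial_ext_smul (L := [r, q]) (by simpa using hs) hΩ hH c f y.2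
  have h0 : (c • f) y = c * f y := by rw [RKHS.coe_smul, Pi.smul_apply, smul_eq_mul]
  simp only [pdeOp, driftTerm, diffusionTerm, h0, h1, h2, mul_left_comm _ c, ← Finset.mul_sum]
  ring

lemma exists_bound_on_bounded (hbdd : Bornology.IsBounded Ω) {f : EuclideanSpace ℝ (Fin d) → ℝ}
    (hf : Continuous f) : ∃ B : ℝ, ∀ y ∈ Ω, |f y| ≤ B := by
  obtain ⟨B, hB⟩ := hbdd.isCompact_closure.exists_bound_of_continuousOn hf.continuousOn
  exact ⟨B, fun y hy => hB y (subset_closure hy)⟩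

/-- Consistency: for an element of the native space that vanishes at the data points, the operator
costs two powers of the fill distance compared with the bound for the values. -/
lemma IsSmoothKernel.exists_pdeOp_bound {m : ℕ} {s : ℝ} (hs : (d : ℝ) / 2 + 2 < s)
    (hΩ : IsOpen Ω) (hbdd : Bornology.IsBounded Ω) (hcone : InteriorCone Ω)
    (hH : IsSmoothKernel H s) {G : EuclideanSpace ℝ (Fin d) → EuclideanSpace ℝ (Fin d)}
    {σ : EuclideanSpace ℝ (Fin d) → Matrix (Fin d) (Fin m) ℝ} (lam : 𝕜) (hG : Continuous G)
    (hσ : ∀ i j, Continuous fun x => σ x i j) :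
    ∃ C : ℝ, 0 ≤ C ∧ ∀ N : ℕ, 0 < N → ∀ (x : Fin N → Ω) (e : H), (∀ i, e (x i) = 0) → ∀ y : Ω,
      ‖e y‖ ≤ C * ‖e‖ * fillDist Ω x ^ (s - d / 2 - 2) ∧
      ‖pdeOp G σ lam e y‖ ≤ C * ‖e‖ * fillDist Ω x ^ (s - d / 2 - 2) := by
  set D := Metric.diam Ω with hD
  have hD0 : 0 ≤ D := Metric.diam_nonneg
  -- Derivatives of lower order satisfy the bound of order two, since the fill distance is at most
  -- the diameter of `Ω`.
  have hder : ∀ L : List (Fin d), ∃ C : ℝ, 0 ≤ C ∧ (L.length ≤ 2 → ∀ N : ℕ, 0 < N →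
      ∀ (x : Fin N → Ω) (e : H), (∀ i, e (x i) = 0) → ∀ y : Ω,
      ‖iterPartial L (ext e) y‖ ≤ C * (‖e‖ * fillDist Ω x ^ (s - d / 2 - 2))) := by
    intro L
    by_cases hL : L.length ≤ 2
    swap
    · exact ⟨0, le_rfl, fun h => absurd h hL⟩
    have hL' : (L.length : ℝ) ≤ 2 := by exact_mod_cast hL
    obtain ⟨C, hC0, hC⟩ := hH.exists_iterPartial_bound (L := L) (by linarith) hΩ hbdd hcone
    refine ⟨C * D ^ (2 - L.length : ℝ), by positivity, fun _ N hN x e he y => ?_⟩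
    refine (hC N hN x e he y).trans ?_
    have hf0 := fillDist_nonneg x
    have h1 : fillDist Ω x ^ (s - d / 2 - L.length)
        = fillDist Ω x ^ (s - d / 2 - 2) * fillDist Ω x ^ (2 - L.length : ℝ) := by
      rw [← Real.rpow_add_of_nonneg hf0 (by linarith) (by linarith)]
      congr 1; ring
    have h2 : fillDist Ω x ^ (2 - L.length : ℝ) ≤ D ^ (2 - L.length : ℝ) :=
      Real.rpow_le_rpow hf0 (fillDist_le_diam hbdd x) (by linarith)
    rw [h1]
    calc _ ≤ C * ‖e‖ * (fillDist Ω x ^ (s - d / 2 - 2) * D ^ (2 - L.length : ℝ)) := by gcongr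
      _ = _ := by ring
  choose K hK0 hK using hder
  choose bG hbG using fun r : Fin d => exists_bound_on_bounded hbdd (f := fun y => G y r)
    (by fun_prop)
  choose ba hba using fun r q : Fin d => exists_bound_on_bounded hbdd
    (f := fun y => (σ y * (σ y).transpose) r q) (by
      simp only [Matrix.mul_apply, Matrix.transpose_apply]
      exact continuous_finsetSum _ fun k _ => (hσ r k).mul (hσ q k))
  set C₁ : ℝ := ∑ r, |bG r| * K [r] with hC₁
  set C₂ : ℝ := 1 / 2 * ∑ r, ∑ q, |ba r q| * K [r, q] with hC₂
  have hC₁0 : 0 ≤ C₁ := Finset.sum_nonneg fun r _ => mul_nonneg (abs_nonneg _) (hK0 _)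
  have hC₂0 : 0 ≤ C₂ := mul_nonneg (by norm_num) (Finset.sum_nonneg fun r _ =>
    Finset.sum_nonneg fun q _ => mul_nonneg (abs_nonneg _) (hK0 _))
  have hK00 := hK0 []
  refine ⟨C₁ + C₂ + (‖lam‖ + 1) * K [], by positivity, fun N hN x e he y => ?_⟩
  set Q := ‖e‖ * fillDist Ω x ^ (s - d / 2 - 2) with hQ
  have hQ0 : 0 ≤ Q := mul_nonneg (norm_nonneg _) (Real.rpow_nonneg (fillDist_nonneg x) _)
  have h0 : ‖e y‖ ≤ K [] * Q := by
    have := hK [] (by simp) N hN x e he y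
    rwa [iterPartial, List.foldr_nil, ext_apply] at this
  have h1 : ‖driftTerm G (ext e) y‖ ≤ C₁ * Q := by
    rw [driftTerm, hC₁, Finset.sum_mul]
    refine (norm_sum_le _ _).trans (Finset.sum_le_sum fun r _ => ?_)
    rw [norm_mul, RCLike.norm_ofReal, mul_assoc]
    exact mul_le_mul ((hbG r y y.2).trans (le_abs_self _)) (hK [r] (by simp) N hN x e he y)
      (norm_nonneg _) (abs_nonneg _)
  have h2 : ‖diffusionTerm σ (ext e) y‖ ≤ C₂ * Q := by
    have hhalf : ‖(1 / 2 : 𝕜)‖ = 1 / 2 := by simp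
    rw [diffusionTerm, hC₂, norm_mul, hhalf, mul_assoc, Finset.sum_mul]
    refine mul_le_mul_of_nonneg_left ?_ (by norm_num)
    refine (norm_sum_le _ _).trans (Finset.sum_le_sum fun r _ => ?_)
    rw [Finset.sum_mul]
    refine (norm_sum_le _ _).trans (Finset.sum_le_sum fun q _ => ?_)
    rw [norm_mul, RCLike.norm_ofReal, mul_assoc]
    exact mul_le_mul ((hba r q y y.2).trans (le_abs_self _))
      (hK [r, q] (by simp) N hN x e he y) (norm_nonneg _) (abs_nonneg _)
  rw [mul_assoc]
  constructor
  · refine h0.trans ?_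
    gcongr
    nlinarith [norm_nonneg lam]
  · rw [pdeOp]
    refine (norm_sub_le _ _).trans ?_
    have h3 := norm_add_le (driftTerm G (ext e) y) (diffusionTerm σ (ext e) y)
    have h4 : ‖lam * e y‖ ≤ ‖lam‖ * (K [] * Q) := by rw [norm_mul]; gcongr
    have h5 : 0 ≤ K [] * Q := by positivity
    linarith

/-! ### Kernel interpolation -/

variable [CompleteSpace H]

variable (H) in
/-- `∑_j α_j k(·, x_j)` as an element of the native space. -/
def kernelElem {N : ℕ} (x : Fin N → Ω) (α : Fin N → 𝕜) : H :=
  ∑ j, α j • RKHS.kerFun H (x j) 1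

lemma kernelElem_apply {N : ℕ} (x : Fin N → Ω) (α : Fin N → 𝕜) (y : Ω) :
    kernelElem H x α y = kernelSum H x α y := by
  have h1 : ⇑(kernelElem H x α) = ∑ j, α j • ⇑(RKHS.kerFun H (x j) (1 : 𝕜)) := by
    rw [kernelElem, ← RKHS.coeCLM_apply, map_sum]
    simp
  rw [h1, kernelSum, Finset.sum_apply]
  simp [ker, RKHS.kerFun_apply]

/-- The interpolation error is orthogonal to the trial space, so its norm is at most that of the
interpolated function. -/
lemma norm_sub_kernelElem_le {N : ℕ} (x : Fin N → Ω) (α : Fin N → 𝕜) (h : H)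
    (hα : ∀ i, (h - kernelElem H x α) (x i) = 0) : ‖h - kernelElem H x α‖ ≤ ‖h‖ := by
  set e := h - kernelElem H x α with he
  have h1 : inner 𝕜 e (kernelElem H x α) = 0 := by
    rw [kernelElem, inner_sum]
    refine Finset.sum_eq_zero fun j _ => ?_
    rw [inner_smul_right, RKHS.inner_kerFun, hα, inner_zero_left, mul_zero]
  have h2 : inner 𝕜 e e = inner 𝕜 e h := by
    conv_lhs => rw [he, inner_sub_right, ← he, h1, sub_zero]
  have h3 : ‖e‖ * ‖e‖ ≤ ‖e‖ * ‖h‖ := by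
    rw [← inner_self_eq_norm_mul_norm (𝕜 := 𝕜), h2]
    exact (RCLike.re_le_norm _).trans (norm_inner_le_norm _ _)
  rcases (norm_nonneg e).eq_or_lt with h0 | h0
  · rw [← h0]; exact norm_nonneg _
  · exact le_of_mul_le_mul_left h3 h0

/-- Interpolants exist even if the kernel matrix is singular: the orthogonal projection onto the
trial space interpolates. -/
lemma exists_interpolant {N : ℕ} (x : Fin N → Ω) (h : H) :
    ∃ β : Fin N → 𝕜, ∀ i, (h - kernelElem H x β) (x i) = 0 := by
  set S : Submodule 𝕜 H := Submodule.span 𝕜 (Set.range fun j => RKHS.kerFun H (x j) (1 : 𝕜))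
    with hS
  have : FiniteDimensional 𝕜 S := FiniteDimensional.span_of_finite 𝕜 (Set.finite_range _)
  obtain ⟨β, hβ⟩ := (Submodule.mem_span_range_iff_exists_fun 𝕜).mp (S.starProjection_apply_mem h)
  refine ⟨β, fun i => ?_⟩
  have h1 := Submodule.sub_starProjection_mem_orthogonal (K := S) h
  rw [← hβ] at h1
  have h2 := (Submodule.mem_orthogonal _ _).mp h1 (RKHS.kerFun H (x i) (1 : 𝕜))
    (Submodule.subset_span ⟨i, rfl⟩)
  rw [RKHS.kerFun_inner] at h2
  simpa [kernelElem] using h2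

/-! ### The collocation system -/

/-- The collocation matrix applies the differential operator to the trial functions. -/
lemma collocationMatrix_mulVec {m N : ℕ} {s : ℝ} (hs : (d : ℝ) / 2 + 2 < s) (hΩ : IsOpen Ω)
    (hH : IsSmoothKernel H s) (G : EuclideanSpace ℝ (Fin d) → EuclideanSpace ℝ (Fin d))
    (σ : EuclideanSpace ℝ (Fin d) → Matrix (Fin d) (Fin m) ℝ) (lam : 𝕜) (x : Fin N → Ω)
    (β : Fin N → 𝕜) (i : Fin N) :
    (collocationMatrix H G σ lam x).mulVec β i = pdeOp G σ lam (kernelElem H x β) (x i) := by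
  let ℓ : H →ₗ[𝕜] 𝕜 :=
    { toFun := fun f => pdeOp G σ lam f (x i)
      map_add' := fun f g => pdeOp_add hs hΩ hH G σ lam f g (x i)
      map_smul' := fun c f => pdeOp_smul hs hΩ hH G σ lam c f (x i) }
  have hℓ : pdeOp G σ lam (kernelElem H x β) (x i)
      = ∑ j, ℓ (β j • RKHS.kerFun H (x j) (1 : 𝕜)) := map_sum ℓ _ _
  rw [hℓ]
  rw [Matrix.mulVec, dotProduct]
  refine Finset.sum_congr rfl fun j _ => ?_
  have h1 : (fun y => ker H y (x j)) = ⇑(RKHS.kerFun H (x j) (1 : 𝕜)) := by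
    funext y
    rw [ker, RKHS.kerFun_apply]
  rw [map_smul, smul_eq_mul, mul_comm]
  congr 1
  change _ = pdeOp G σ lam _ (x i)
  simp only [collocationMatrix, driftMatrix, diffusionMatrix, gramMatrix, Matrix.sub_apply,
    Matrix.add_apply, Matrix.smul_apply, Matrix.of_apply, smul_eq_mul, h1, pdeOp]
  rw [ker, RKHS.kerFun_apply]

lemma collocationCond_nonneg {N : ℕ} (x : Fin N → Ω) (A : Matrix (Fin N) (Fin N) 𝕜) :
    0 ≤ collocationCond H x A :=
  Real.iSup_nonneg fun _ => Finset.sum_nonneg fun _ _ => norm_nonneg _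

/-- Stability: trial functions are controlled by their collocation data. -/
lemma norm_kernelSum_le_collocationCond {N : ℕ} {s : ℝ} (hs : (d : ℝ) / 2 < s)
    (hH : IsSmoothKernel H s) (x : Fin N → Ω) {A : Matrix (Fin N) (Fin N) 𝕜} (hA : IsUnit A)
    (γ : Fin N → 𝕜) {b : ℝ} (hb : ∀ i, ‖A.mulVec γ i‖ ≤ b) (y : Ω) :
    ‖kernelSum H x γ y‖ ≤ collocationCond H x A * b := by
  obtain ⟨B, hB⟩ := hH.exists_norm_apply_le hs
  have hker : ∀ (y : Ω) j, ‖ker H y (x j)‖ ≤ B * ‖RKHS.kerFun H (x j) (1 : 𝕜)‖ := fun y j => by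
    rw [ker, ← RKHS.kerFun_apply]
    exact hB _ y
  have hbd : BddAbove (Set.range fun y : Ω => ∑ i, ‖∑ j, ker H y (x j) * A⁻¹ j i‖) := by
    refine ⟨∑ i, ∑ j, B * ‖RKHS.kerFun H (x j) (1 : 𝕜)‖ * ‖A⁻¹ j i‖, ?_⟩
    rintro _ ⟨y, rfl⟩
    refine Finset.sum_le_sum fun i _ => (norm_sum_le _ _).trans (Finset.sum_le_sum fun j _ => ?_)
    rw [norm_mul]
    gcongr
    exact hker y j
  have hγ : γ = A⁻¹.mulVec (A.mulVec γ) := by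
    rw [Matrix.mulVec_mulVec, Matrix.nonsing_inv_mul _ ((Matrix.isUnit_iff_isUnit_det A).mp hA),
      Matrix.one_mulVec]
  have h1 : kernelSum H x γ y
      = ∑ i, (∑ j, ker H y (x j) * A⁻¹ j i) * A.mulVec γ i := by
    rw [kernelSum]
    conv_lhs => rw [hγ]
    generalize A.mulVec γ = c
    simp only [Matrix.mulVec, dotProduct, Finset.sum_mul]
    rw [Finset.sum_comm]
    refine Finset.sum_congr rfl fun i _ => Finset.sum_congr rfl fun j _ => ?_
    ring
  rw [h1]
  calc _ ≤ ∑ i, ‖∑ j, ker H y (x j) * A⁻¹ j i‖ * b := by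
        refine (norm_sum_le _ _).trans (Finset.sum_le_sum fun i _ => ?_)
        rw [norm_mul]
        gcongr
        exact hb i
    _ = (∑ i, ‖∑ j, ker H y (x j) * A⁻¹ j i‖) * b := by rw [Finset.sum_mul]
    _ ≤ collocationCond H x A * b := by
        rcases N.eq_zero_or_pos with rfl | hN
        · simp [collocationCond]
        · exact mul_le_mul_of_nonneg_right (le_ciSup hbd y) ((norm_nonneg _).trans (hb ⟨0, hN⟩))

end NativeSpace

end KoopmanCollocation

end

theorem mainTheorem5 {𝕜 : Type*} [RCLike 𝕜] {d : ℕ}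
    (Ω : Set (EuclideanSpace ℝ (Fin d))) (hΩ_open : IsOpen Ω)
    (hΩ_bdd : Bornology.IsBounded Ω) (hΩ_cone : KoopmanCollocation.InteriorCone Ω)
    (H : Type*) [NormedAddCommGroup H] [InnerProductSpace 𝕜 H] [CompleteSpace H]
    [RKHS 𝕜 H Ω 𝕜]
    (s : ℝ) (hs : (d : ℝ) / 2 < s) (hH : KoopmanCollocation.IsSmoothKernel H s) :
    -- collocation of the values (kernel interpolation)
    (∃ C : ℝ, 0 < C ∧ ∀ (N : ℕ), 0 < N → ∀ (x : Fin N → Ω) (h : H) (α : Fin N → 𝕜),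
      (KoopmanCollocation.gramMatrix H x).mulVec α = (fun i => h (x i)) →
      ∀ y : Ω, ‖h y - KoopmanCollocation.kernelSum H x α y‖ ≤
        C * ‖h‖ * KoopmanCollocation.fillDist Ω x ^ (s - d / 2)) ∧
    -- collocation of the differential equation
    ((d : ℝ) / 2 + 2 < s →
      ∀ (m : ℕ) (G : EuclideanSpace ℝ (Fin d) → EuclideanSpace ℝ (Fin d))
        (σ : EuclideanSpace ℝ (Fin d) → Matrix (Fin d) (Fin m) ℝ) (lam : 𝕜),
      ContDiff ℝ 2 G → (∀ i j, ContDiff ℝ 2 (fun x => σ x i j)) →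
      ∃ C : ℝ, 0 < C ∧ ∀ (N : ℕ), 0 < N → ∀ (x : Fin N → Ω) (w : Fin d → 𝕜) (h : H)
        (α : Fin N → 𝕜),
      KoopmanCollocation.IsSolution Ω G σ lam w h →
      IsUnit (KoopmanCollocation.collocationMatrix H G σ lam x) →
      (KoopmanCollocation.collocationMatrix H G σ lam x).mulVec α =
        (fun i => - KoopmanCollocation.source G w (x i)) →
      ∀ y : Ω, ‖h y - KoopmanCollocation.kernelSum H x α y‖ ≤
        C * (1 + KoopmanCollocation.collocationCond H x
            (KoopmanCollocation.collocationMatrix H G σ lam x)) *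
          ‖h‖ * KoopmanCollocation.fillDist Ω x ^ (s - d / 2 - 2)) := by
  open KoopmanCollocation in
  refine ⟨?_, fun hs2 m G σ lam hG hσ => ?_⟩
  · obtain ⟨C, hC0, hC⟩ := hH.exists_iterPartial_bound (L := ([] : List (Fin d)))
      (by simpa using hs) hΩ_open hΩ_bdd hΩ_cone
    refine ⟨C + 1, by linarith, fun N hN x h α hα y => ?_⟩
    have he : ∀ i, (h - kernelElem H x α) (x i) = 0 := fun i => by
      have h1 := congrFun hα i
      rw [RKHS.coe_sub, Pi.sub_apply, kernelElem_apply, ← h1, sub_eq_zero]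
      rw [Matrix.mulVec, dotProduct, kernelSum]
      exact Finset.sum_congr rfl fun j _ => mul_comm _ (α j)
    have h2 := hC N hN x _ he y
    simp only [iterPartial, List.foldr_nil, List.length_nil, Nat.cast_zero, sub_zero] at h2
    rw [ext_apply, RKHS.coe_sub, Pi.sub_apply, kernelElem_apply] at h2
    refine h2.trans ?_
    have := Real.rpow_nonneg (fillDist_nonneg x) (s - d / 2)
    gcongr
    · linarith
    · exact norm_sub_kernelElem_le x α h he
  · obtain ⟨C, hC0, hC⟩ := hH.exists_pdeOp_bound hs2 hΩ_open hΩ_bdd hΩ_cone lam hG.continuous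
      (fun i j => (hσ i j).continuous)
    refine ⟨C + 1, by linarith, fun N hN x w h α hsol hA hα y => ?_⟩
    set A := collocationMatrix H G σ lam x with hAdef
    -- The collocation solution is compared with the interpolant of the exact solution.
    obtain ⟨β, hβ⟩ := exists_interpolant x h
    have hnorm := norm_sub_kernelElem_le x β h hβ
    set e := h - kernelElem H x β with he
    set F := fillDist Ω x ^ (s - d / 2 - 2) with hF
    have hF0 : 0 ≤ F := Real.rpow_nonneg (fillDist_nonneg x) _
    have hsplit : h = kernelElem H x β + e := by rw [he]; abel
    -- `A (α - β)` is the vector of residuals of the interpolation error at the data points.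
    have hres : ∀ i, ‖A.mulVec (α - β) i‖ ≤ C * ‖e‖ * F := fun i => by
      have h1 : pdeOp G σ lam h (x i) = - source G w (x i) := hsol.2 (x i)
      have h2 : pdeOp G σ lam h (x i)
          = pdeOp G σ lam (kernelElem H x β) (x i) + pdeOp G σ lam e (x i) := by
        conv_lhs => rw [hsplit]
        exact pdeOp_add hs2 hΩ_open hH G σ lam _ _ _
      have h3 : A.mulVec (α - β) i = pdeOp G σ lam e (x i) := by
        have h4 : A.mulVec α i = pdeOp G σ lam h (x i) := (congrFun hα i).trans h1.symm
        rw [Matrix.mulVec_sub, Pi.sub_apply, h4,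
          collocationMatrix_mulVec hs2 hΩ_open hH, h2, add_sub_cancel_left]
      rw [h3]
      exact (hC N hN x e hβ (x i)).2
    have hstab := norm_kernelSum_le_collocationCond hs hH x hA (α - β) hres y
    have herr := (hC N hN x e hβ y).1
    have hdecomp : h y - kernelSum H x α y = e y - kernelSum H x (α - β) y := by
      rw [he, RKHS.coe_sub, Pi.sub_apply, kernelElem_apply]
      simp only [kernelSum, Pi.sub_apply, sub_mul, Finset.sum_sub_distrib]
      ring
    have hκ := collocationCond_nonneg (H := H) x A
    rw [hdecomp]
    calc ‖e y - kernelSum H x (α - β) y‖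
        ≤ C * ‖e‖ * F + collocationCond H x A * (C * ‖e‖ * F) :=
          (norm_sub_le _ _).trans (add_le_add herr hstab)
      _ = C * (1 + collocationCond H x A) * ‖e‖ * F := by ring
      _ ≤ (C + 1) * (1 + collocationCond H x A) * ‖h‖ * F := by
          gcongr
          linarith
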